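/- There are $n\ge 1$ agents and $m\ge 0$ indivisible chores. Agent $i$ has cost $c_i(e)\ge 0$ for chore $e$, extended additively to bundles by $c_i(S)=\sum_{e\in S}c_i(e)$. The instance is *restricted* if there is a function $c$ on the chores with $c_i(e)\in\{0,c(e)\}$ for all $i,e$. An allocation $X=(X_1,\dots,X_n)$ is an ordered partition of the chores into $n$ (possibly empty) bundles. It is - *EF1* if for all agents $i,j$, either $X_i=\emptyset$ or some $e\in X_i$ satisfies $c_i(X_i\setminus\{e\})\le c_i(X_j)$; - *$\alpha$-MMS* if $c_i(X_i)\le\alpha\cdot\mathrm{MMS}_i$ for all $i$, where $\mathrm{MMS}_i=\min_{(B_1,\dots,B_n)}\max_j c_i(B_j)$, the minimum being over all partitions of the chores into $n$ bundles; - *Pareto optimal (PO)* if no allocation $X'$ satisfies $c_i(X'_i)\le c_i(X_i)$ for all $i$ with strict inequality for some $i$. **Corollary.** For every fixed $\varepsilon>0$ there is an algorithm that, given a restricted instance $(n,m,(c_i(e))_{i,e})$, computes in polynomial time an allocation that is EF1, $(1+\varepsilon)$-MMS and PO. Here the algorithm is a program for a random access machine whose only operations on numbers are constants, addition, subtraction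 and comparison, with indirect addressing. Polynomial time (with polynomials that may depend on $\varepsilon$) means, for one and the same program: for real costs, the number of steps at unit cost per operation is bounded by a polynomial in $n+m$; and for rational costs, the running time in which every operation is charged the binary length of the numbers involved (logarithmic cost) is bounded by a polynomial in the binary length of the instance. -/

import Mathlib

namespace Chores

/-! ## Fair division of indivisible chores

There are `n` agents `Fin n` and `m` items `Fin m`; `c i e` is the cost of item `e` to agent `i`.
An allocation (an ordered partition of the items into `n` possibly empty bundles) is a map
`a : Fin m → Fin n` that sends each item to the agent who receives it. -/

/-- The additive cost of a set of items to agent `i`. -/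
def cost {n m : ℕ} (c : Fin n → Fin m → ℝ) (i : Fin n) (S : Finset (Fin m)) : ℝ :=
  ∑ e ∈ S, c i e

/-- The bundle `X_i` of agent `i` in the allocation `a`. -/
def bundle {n m : ℕ} (a : Fin m → Fin n) (i : Fin n) : Finset (Fin m) :=
  Finset.univ.filter fun e => a e = i

/-- A restricted instance: the costs are nonnegative and every item `e` has an inherent cost
`c₀ e` such that each agent has cost `0` or `c₀ e` for it. -/
def IsRestricted {n m : ℕ} (c : Fin n → Fin m → ℝ) : Prop :=
  (∀ i e, 0 ≤ c i e) ∧ ∃ c₀ : Fin m → ℝ, ∀ i e, c i e = 0 ∨ c i e = c₀ e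

/-- Envy-freeness up to one item. -/
def IsEF1 {n m : ℕ} (c : Fin n → Fin m → ℝ) (a : Fin m → Fin n) : Prop :=
  ∀ i j, bundle a i = ∅ ∨
    ∃ e ∈ bundle a i, cost c i ((bundle a i).erase e) ≤ cost c i (bundle a j)

/-- The maximin share of agent `i`: the minimum over all partitions of the items into `n` bundles
of the largest cost of a bundle to agent `i`. (Both index types are finite, and nonempty for
`0 < n`, so that the infimum and the supremum are a minimum and a maximum.) -/
noncomputable def mms {n m : ℕ} (c : Fin n → Fin m → ℝ) (i : Fin n) : ℝ :=
  ⨅ b : Fin m → Fin n, ⨆ j : Fin n, cost c i (bundle b j)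

/-- The `α`-approximate maximin share guarantee. -/
def IsApproxMMS {n m : ℕ} (α : ℝ) (c : Fin n → Fin m → ℝ) (a : Fin m → Fin n) : Prop :=
  ∀ i, cost c i (bundle a i) ≤ α * mms c i

/-- The allocation `b` Pareto dominates the allocation `a`. -/
def ParetoDominates {n m : ℕ} (c : Fin n → Fin m → ℝ) (b a : Fin m → Fin n) : Prop :=
  (∀ i, cost c i (bundle b i) ≤ cost c i (bundle a i)) ∧
    ∃ i, cost c i (bundle b i) < cost c i (bundle a i)

/-- Pareto optimality. -/
def IsPO {n m : ℕ} (c : Fin n → Fin m → ℝ) (a : Fin m → Fin n) : Prop :=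
  ¬ ∃ b : Fin m → Fin n, ParetoDominates c b a

/-! ## The machine model

A random access machine, programmed in a structured (while-) language. It stores natural numbers
(registers and arrays, used for indices and counters) and elements of a number type `K` (arrays,
used for costs). The only operations are constants, addition, subtraction, comparison and
indirect addressing. There is no multiplication, so that numbers grow by at most about one bit
per operation. The syntax of programs does not mention `K`: the same program runs on real and on
rational numbers. -/

/-- Expressions whose value is a natural number. -/
inductive NExp : Type
  | lit (k : ℕ)
  | reg (x : ℕ)
  | get (a : ℕ) (i : NExp)
  | add (u v : NExp)
  | sub (u v : NExp)

/-- Expressions whose value lies in the number type. -/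
inductive VExp : Type
  | zero
  | get (a : ℕ) (i : NExp)
  | add (u v : VExp)
  | sub (u v : VExp)

/-- Tests. -/
inductive BExp : Type
  | nlt (u v : NExp)
  | vlt (u v : VExp)
  | neg (b : BExp)
  | conj (b d : BExp)

/-- Programs. -/
inductive Cmd : Type
  | skip
  | setReg (x : ℕ) (u : NExp)
  | setNat (a : ℕ) (i : NExp) (u : NExp)
  | setVal (a : ℕ) (i : NExp) (u : VExp)
  | seq (p q : Cmd)
  | branch (b : BExp) (p q : Cmd)
  | loop (b : BExp) (p : Cmd)

/-- The contents of the memory: `reg x` is register `x`, `nat a k` is cell `k` of the array `a` of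
natural numbers, `val a k` is cell `k` of the array `a` of elements of `K`. -/
@[ext]
structure State (K : Type) where
  reg : ℕ → ℕ
  nat : ℕ → ℕ → ℕ
  val : ℕ → ℕ → K

/-- What is charged, on top of one unit, for an operation whose result is a given number. -/
structure Charge (K : Type) where
  nat : ℕ → ℕ
  val : K → ℕ

/-- Unit cost: every operation takes one step. -/
def unitCharge (K : Type) : Charge K := ⟨fun _ => 0, fun _ => 0⟩

/-- The binary length of a rational number: sign, numerator and denominator. -/
def ratBits (q : ℚ) : ℕ := 1 + Nat.size q.num.natAbs + Nat.size q.den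

/-- Logarithmic cost: every operation is charged the binary length of the number it handles. -/
def bitCharge : Charge ℚ := ⟨Nat.size, ratBits⟩

section Semantics

variable {K : Type}

/-- The value of an expression (subtraction of natural numbers is truncated at `0`). -/
def NExp.eval (s : State K) : NExp → ℕ
  | .lit k => k
  | .reg x => s.reg x
  | .get a i => s.nat a (i.eval s)
  | .add u v => u.eval s + v.eval s
  | .sub u v => u.eval s - v.eval s

/-- The time for evaluating an expression. -/
def NExp.time (w : Charge K) (s : State K) : NExp → ℕ
  | .lit k => 1 + w.nat k
  | .reg x => 1 + w.nat (s.reg x)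
  | .get a i => i.time w s + 1 + w.nat ((NExp.get a i).eval s)
  | .add u v => u.time w s + v.time w s + 1 + w.nat ((NExp.add u v).eval s)
  | .sub u v => u.time w s + v.time w s + 1 + w.nat ((NExp.sub u v).eval s)

/-- The value of an expression. -/
def VExp.eval [Zero K] [Add K] [Sub K] (s : State K) : VExp → K
  | .zero => 0
  | .get a i => s.val a (i.eval s)
  | .add u v => u.eval s + v.eval s
  | .sub u v => u.eval s - v.eval s

/-- The time for evaluating an expression. -/
def VExp.time [Zero K] [Add K] [Sub K] (w : Charge K) (s : State K) : VExp → ℕ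
  | .zero => 1 + w.val 0
  | .get a i => i.time w s + 1 + w.val ((VExp.get a i).eval s)
  | .add u v => u.time w s + v.time w s + 1 + w.val ((VExp.add u v).eval s)
  | .sub u v => u.time w s + v.time w s + 1 + w.val ((VExp.sub u v).eval s)

/-- The truth value of a test. -/
def BExp.eval [Zero K] [Add K] [Sub K] [LT K] (s : State K) : BExp → Prop
  | .nlt u v => u.eval s < v.eval s
  | .vlt u v => u.eval s < v.eval s
  | .neg b => ¬ b.eval s
  | .conj b d => b.eval s ∧ d.eval s

/-- The time for evaluating a test. -/
def BExp.time [Zero K] [Add K] [Sub K] (w : Charge K) (s : State K) : BExp → ℕ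
  | .nlt u v => u.time w s + v.time w s + 1
  | .vlt u v => u.time w s + v.time w s + 1
  | .neg b => b.time w s + 1
  | .conj b d => b.time w s + d.time w s + 1

/-- Write `v` into register `x`. -/
def State.putReg (s : State K) (x v : ℕ) : State K :=
  { s with reg := Function.update s.reg x v }

/-- Write `v` into cell `k` of the array `a` of natural numbers. -/
def State.putNat (s : State K) (a k v : ℕ) : State K :=
  { s with nat := Function.update s.nat a (Function.update (s.nat a) k v) }

/-- Write `v` into cell `k` of the array `a` of elements of `K`. -/
def State.putVal (s : State K) (a k : ℕ) (v : K) : State K :=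
  { s with val := Function.update s.val a (Function.update (s.val a) k v) }

/-- `Exec w p s t s'`: started in state `s`, the program `p` halts after time `t` (measured with
the charge `w`) in state `s'`. -/
inductive Exec [Zero K] [Add K] [Sub K] [LT K] (w : Charge K) :
    Cmd → State K → ℕ → State K → Prop
  | skip (s : State K) : Exec w .skip s 1 s
  | setReg (s : State K) (x : ℕ) (u : NExp) :
      Exec w (.setReg x u) s (u.time w s + 1) (s.putReg x (u.eval s))
  | setNat (s : State K) (a : ℕ) (i u : NExp) :
      Exec w (.setNat a i u) s (i.time w s + u.time w s + 1)
        (s.putNat a (i.eval s) (u.eval s))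
  | setVal (s : State K) (a : ℕ) (i : NExp) (u : VExp) :
      Exec w (.setVal a i u) s (i.time w s + u.time w s + 1)
        (s.putVal a (i.eval s) (u.eval s))
  | seq {p q : Cmd} {s₁ s₂ s₃ : State K} {t₁ t₂ : ℕ} :
      Exec w p s₁ t₁ s₂ → Exec w q s₂ t₂ s₃ → Exec w (.seq p q) s₁ (t₁ + t₂) s₃
  | branch_true {b : BExp} {p q : Cmd} {s s' : State K} {t : ℕ} :
      b.eval s → Exec w p s t s' → Exec w (.branch b p q) s (b.time w s + 1 + t) s'
  | branch_false {b : BExp} {p q : Cmd} {s s' : State K} {t : ℕ} :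
      ¬ b.eval s → Exec w q s t s' → Exec w (.branch b p q) s (b.time w s + 1 + t) s'
  | loop_true {b : BExp} {p : Cmd} {s₁ s₂ s₃ : State K} {t₁ t₂ : ℕ} :
      b.eval s₁ → Exec w p s₁ t₁ s₂ → Exec w (.loop b p) s₂ t₂ s₃ →
        Exec w (.loop b p) s₁ (b.time w s₁ + 1 + t₁ + t₂) s₃
  | loop_false {b : BExp} {p : Cmd} {s : State K} :
      ¬ b.eval s → Exec w (.loop b p) s (b.time w s + 1) s

/-- The input of a program: register `0` holds the number `n` of agents, register `1` the number
`m` of items, the array `0` of elements of `K` holds the cost matrix row by row (the cost of item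
`e` to agent `i` is in cell `i * m + e`), and everything else is `0`. -/
def inputState [Zero K] {n m : ℕ} (c : Fin n → Fin m → K) : State K where
  reg x := if x = 0 then n else if x = 1 then m else 0
  nat _ _ := 0
  val a k :=
    if h : a = 0 ∧ k < n * m then
      c ⟨k / m, Nat.div_lt_of_lt_mul (by rw [Nat.mul_comm]; exact h.2)⟩
        ⟨k % m, Nat.mod_lt _ (Nat.pos_of_mul_pos_left (Nat.zero_lt_of_lt h.2))⟩
    else 0

/-- The output of a program: cell `e` of the array `0` of natural numbers holds the (number of
the) agent who receives item `e`. -/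
def Outputs {n m : ℕ} (s : State K) (a : Fin m → Fin n) : Prop :=
  ∀ e : Fin m, s.nat 0 e = (a e : ℕ)

end Semantics

/-- The binary length of an instance with rational costs. -/
def inputBits {n m : ℕ} (c : Fin n → Fin m → ℚ) : ℕ :=
  n + m + ∑ i, ∑ e, ratBits (c i e)

end Chores

/-! Only the items that cost every agent something matter: all other items go to an agent for whom
they are free. The remaining items have common costs `d`, so that every allocation that treats the
free items in this way minimizes the total cost of all agents and hence is Pareto optimal, and EF1
and the maximin share reduce to scheduling the costs `d` on `n` identical machines
(`guarantees_of_schedule`).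

*Fairness.* Offer each item once, in any order, to the currently least loaded machine, and move it
there if the load of its present machine without the item exceeds the least load. This neither
raises the makespan nor lowers the least load, and after its turn an item witnesses that its machine
is least loaded without it. A machine that receives an item later gets a new witness. So a single
pass makes an arbitrary schedule EF1 (`PassInv`, `PassInv.move`, `PassInv.fair`).

*Approximation.* Let `G` be the makespan of a first EF1 schedule, which is at most twice the
optimum. Round the costs down to multiples of `G / K` for `K = 2 * k ^ 2`, and call an item large if
its rounded cost is at least `k * G / K`. Rounding underestimates a set of large items by a factor
of at most `1 + 1 / k`, so it suffices to find out how many items of each rounded cost an optimal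
schedule puts on each machine (`large_load_le`). There are at most `numConf K` such configurations
of a machine. As machines are interchangeable, they may be sorted by their configurations, and then
`numConf K` thresholds between `0` and `n` describe all of them (`exists_guess`). The program tries
all values of the thresholds. For each it distributes the large items accordingly, makes a pass over
the small items, which leaves a machine with a small item at most one small item above the average
load (`load_le_of_classCount`), makes a pass over all items, and keeps the best schedule.

*Running time.* The program consists of counting loops only, each bounded by `n`, `n + 1` or `m`, so
that its number of steps is polynomial (`Prog.exec_compile`). A computation with rational numbers
costs only polynomially more at logarithmic cost: without multiplication, the product of all
denominators of the input remains a common denominator, and numerators at most double in a unit of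
time (`Exec.bitCharge_of_unitCharge`).
-/

namespace Chores

/-! ### Loop programs -/

/-- Programs all of whose loops are counting loops: `loop x r k p` runs `p` with `0, 1, …` in
register `x`, as often as (the contents of register `r`) `+ k` says. -/
inductive Prog : Type
  | skip
  | setReg (x : ℕ) (u : NExp)
  | setNat (a : ℕ) (i : NExp) (u : NExp)
  | setVal (a : ℕ) (i : NExp) (u : VExp)
  | seq (p q : Prog)
  | branch (b : BExp) (p q : Prog)
  | loop (x r k : ℕ) (p : Prog)

namespace Prog

/-- The translation of loop programs into the language of the machine. -/
def compile : Prog → Cmd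
  | skip => .skip
  | setReg x u => .setReg x u
  | setNat a i u => .setNat a i u
  | setVal a i u => .setVal a i u
  | seq p q => .seq p.compile q.compile
  | branch b p q => .branch b p.compile q.compile
  | loop x r k p => .seq (.setReg x (.lit 0))
      (.loop (.nlt (.reg x) (.add (.reg r) (.lit k)))
        (.seq p.compile (.setReg x (.add (.reg x) (.lit 1)))))

open Classical in
/-- The effect of a loop program on the memory, as a function. -/
noncomputable def run : Prog → State ℝ → State ℝ
  | skip, s => s
  | setReg x u, s => s.putReg x (u.eval s)
  | setNat a i u, s => s.putNat a (i.eval s) (u.eval s)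
  | setVal a i u, s => s.putVal a (i.eval s) (u.eval s)
  | seq p q, s => q.run (p.run s)
  | branch b p q, s => if b.eval s then p.run s else q.run s
  | loop x r k p, s =>
      (fun t => (p.run t).putReg x ((p.run t).reg x + 1))^[s.reg r + k] (s.putReg x 0)

/-- `p.writesReg y`: register `y` is the target of an assignment in `p`. -/
def writesReg : Prog → ℕ → Prop
  | setReg x _, y => y = x
  | seq p q, y => p.writesReg y ∨ q.writesReg y
  | branch _ p q, y => p.writesReg y ∨ q.writesReg y
  | loop x _ _ p, y => y = x ∨ p.writesReg y
  | _, _ => False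

/-- `p.writesNat a`: some cell of the array `a` of natural numbers is the target of an assignment
in `p`. -/
def writesNat : Prog → ℕ → Prop
  | setNat a _ _, b => b = a
  | seq p q, b => p.writesNat b ∨ q.writesNat b
  | branch _ p q, b => p.writesNat b ∨ q.writesNat b
  | loop _ _ _ p, b => p.writesNat b
  | _, _ => False

/-- `p.writesVal a`: some cell of the array `a` of costs is the target of an assignment in `p`. -/
def writesVal : Prog → ℕ → Prop
  | setVal a _ _, b => b = a
  | seq p q, b => p.writesVal b ∨ q.writesVal b
  | branch _ p q, b => p.writesVal b ∨ q.writesVal b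
  | loop _ _ _ p, b => p.writesVal b
  | _, _ => False

/-- The registers `0` and `1`, which hold the size of the instance, are read-only, they alone bound
the loops, and no loop body changes the counter of its loop. -/
def WF : Prog → Prop
  | setReg x _ => 2 ≤ x
  | seq p q => p.WF ∧ q.WF
  | branch _ p q => p.WF ∧ q.WF
  | loop x r _ p => 2 ≤ x ∧ r < 2 ∧ ¬ p.writesReg x ∧ p.WF
  | _ => True

/-- Two memories agree except for what `p` may write. -/
structure Frame (p : Prog) (s t : State ℝ) : Prop where
  reg : ∀ y, ¬ p.writesReg y → t.reg y = s.reg y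
  nat : ∀ a, ¬ p.writesNat a → t.nat a = s.nat a
  val : ∀ a, ¬ p.writesVal a → t.val a = s.val a

end Prog

section StateLemmas
variable {K : Type} (s : State K)

@[simp] theorem putReg_nat (x v : ℕ) : (s.putReg x v).nat = s.nat := rfl
@[simp] theorem putReg_val (x v : ℕ) : (s.putReg x v).val = s.val := rfl
@[simp] theorem putNat_reg (a k v : ℕ) : (s.putNat a k v).reg = s.reg := rfl
@[simp] theorem putNat_val (a k v : ℕ) : (s.putNat a k v).val = s.val := rfl
@[simp] theorem putVal_reg (a k : ℕ) (v : K) : (s.putVal a k v).reg = s.reg := rfl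
@[simp] theorem putVal_nat (a k : ℕ) (v : K) : (s.putVal a k v).nat = s.nat := rfl
@[simp] theorem putReg_reg (x v y : ℕ) :
    (s.putReg x v).reg y = if y = x then v else s.reg y := by
  simp [State.putReg, Function.update_apply]
@[simp] theorem putNat_nat (a k v b : ℕ) :
    (s.putNat a k v).nat b = if b = a then Function.update (s.nat a) k v else s.nat b := by
  simp [State.putNat, Function.update_apply]
@[simp] theorem putVal_val (a k : ℕ) (v : K) (b : ℕ) :
    (s.putVal a k v).val b = if b = a then Function.update (s.val a) k v else s.val b := by
  simp [State.putVal, Function.update_apply]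

end StateLemmas

namespace Prog

theorem run_seq (p q : Prog) (s : State ℝ) : (seq p q).run s = q.run (p.run s) := rfl

theorem run_setReg (x : ℕ) (u : NExp) (s : State ℝ) :
    (setReg x u).run s = s.putReg x (u.eval s) := rfl

theorem Frame.refl (p : Prog) (s : State ℝ) : Frame p s s :=
  ⟨fun _ _ => rfl, fun _ _ => rfl, fun _ _ => rfl⟩

theorem Frame.trans {p : Prog} {s t u : State ℝ} (h : Frame p s t) (h' : Frame p t u) :
    Frame p s u :=
  ⟨fun y hy => (h'.reg y hy).trans (h.reg y hy), fun y hy => (h'.nat y hy).trans (h.nat y hy),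
    fun y hy => (h'.val y hy).trans (h.val y hy)⟩

theorem Frame.mono {p q : Prog} {s t : State ℝ} (h : Frame p s t)
    (h1 : ∀ y, p.writesReg y → q.writesReg y) (h2 : ∀ y, p.writesNat y → q.writesNat y)
    (h3 : ∀ y, p.writesVal y → q.writesVal y) : Frame q s t :=
  ⟨fun y hy => h.reg y (mt (h1 y) hy), fun y hy => h.nat y (mt (h2 y) hy),
    fun y hy => h.val y (mt (h3 y) hy)⟩

theorem frame_run (p : Prog) (s : State ℝ) : Frame p s (p.run s) := by
  induction p generalizing s with
  | skip => exact Frame.refl _ _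
  | setReg x u => exact ⟨fun y hy => by simp_all [run, writesReg], by simp [run], by simp [run]⟩
  | setNat a i u => exact ⟨by simp [run], fun y hy => by simp_all [run, writesNat], by simp [run]⟩
  | setVal a i u => exact ⟨by simp [run], by simp [run], fun y hy => by simp_all [run, writesVal]⟩
  | seq p q hp hq =>
    refine Frame.trans ((hp s).mono ?_ ?_ ?_) ((hq (p.run s)).mono ?_ ?_ ?_) <;>
      simp +contextual [writesReg, writesNat, writesVal]
  | branch b p q hp hq =>
    rw [run]
    split_ifs
    · exact (hp s).mono (fun _ => Or.inl) (fun _ => Or.inl) (fun _ => Or.inl)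
    · exact (hq s).mono (fun _ => Or.inr) (fun _ => Or.inr) (fun _ => Or.inr)
  | loop x r k p hp =>
    have hput : ∀ (t : State ℝ) v, Frame (loop x r k p) t (t.putReg x v) := fun t v =>
      ⟨fun y hy => by simp_all [writesReg], by simp, by simp⟩
    rw [run]
    generalize s.reg r + k = N
    induction N with
    | zero => exact hput _ _
    | succ N ih =>
      rw [Function.iterate_succ_apply']
      exact ih.trans (Frame.trans ((hp _).mono (fun _ => Or.inr) (fun _ => id) (fun _ => id))
        (hput _ _))

/-- The induction principle for a counting loop. The body may assume that the counter holds the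
number of the iteration and that everything the loop does not write is as it was at its start. -/
theorem run_loop {x r k : ℕ} {p : Prog} {s : State ℝ} (I : ℕ → State ℝ → Prop)
    (hx : ¬ p.writesReg x) (h0 : I 0 (s.putReg x 0))
    (hstep : ∀ i t, i < s.reg r + k → t.reg x = i → Frame (loop x r k p) s t → I i t →
      I (i + 1) ((p.run t).putReg x (i + 1))) :
    I (s.reg r + k) ((loop x r k p).run s) := by
  have key : ∀ N, N ≤ s.reg r + k →
      ((fun t => (p.run t).putReg x ((p.run t).reg x + 1))^[N] (s.putReg x 0)).reg x = N ∧
      Frame (loop x r k p) s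
        ((fun t => (p.run t).putReg x ((p.run t).reg x + 1))^[N] (s.putReg x 0)) ∧
      I N ((fun t => (p.run t).putReg x ((p.run t).reg x + 1))^[N] (s.putReg x 0)) := by
    have hput : ∀ (t : State ℝ) v, Frame (loop x r k p) t (t.putReg x v) := fun t v =>
      ⟨fun y hy => by simp_all [writesReg], by simp, by simp⟩
    intro N hN
    induction N with
    | zero => exact ⟨by simp, hput _ _, h0⟩
    | succ N ih =>
      obtain ⟨h1, h2, h3⟩ := ih (by omega)
      rw [Function.iterate_succ_apply']
      set t := (fun t => (p.run t).putReg x ((p.run t).reg x + 1))^[N] (s.putReg x 0)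
      have h4 : (p.run t).reg x = N := by rw [(frame_run p t).reg x hx, h1]
      refine ⟨by simp [h4], ?_, ?_⟩
      · exact h2.trans (Frame.trans ((frame_run p t).mono (fun _ => Or.inr) (fun _ => id)
          (fun _ => id)) (hput _ _))
      · simp only [h4]
        exact hstep N t (by omega) h1 h2 h3
  exact (key _ le_rfl).2.2

theorem WF.not_writesReg {p : Prog} (h : p.WF) {y : ℕ} (hy : y < 2) : ¬ p.writesReg y := by
  induction p with
  | skip | setNat | setVal => exact id
  | setReg x u => simp only [WF, writesReg] at *; omega
  | seq p q hp hq | branch b p q hp hq => exact not_or.2 ⟨hp h.1, hq h.2⟩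
  | loop x r k p hp =>
    obtain ⟨h1, h2, h3, h4⟩ := h
    exact not_or.2 ⟨by omega, hp h4⟩

end Prog

/-- The number of nodes of an expression, which is its evaluation time at unit cost. -/
def NExp.nodes : NExp → ℕ
  | .lit _ | .reg _ => 1
  | .get _ i => i.nodes + 1
  | .add u v | .sub u v => u.nodes + v.nodes + 1

/-- The number of nodes of an expression, which is its evaluation time at unit cost. -/
def VExp.nodes : VExp → ℕ
  | .zero => 1
  | .get _ i => i.nodes + 1
  | .add u v | .sub u v => u.nodes + v.nodes + 1

/-- The number of nodes of a test, which is its evaluation time at unit cost. -/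
def BExp.nodes : BExp → ℕ
  | .nlt u v => u.nodes + v.nodes + 1
  | .vlt u v => u.nodes + v.nodes + 1
  | .neg b => b.nodes + 1
  | .conj b d => b.nodes + d.nodes + 1

section UnitTime
variable {K : Type} (s : State K)

theorem NExp.time_unit (u : NExp) : u.time (unitCharge K) s = u.nodes := by
  induction u <;> simp_all [NExp.time, NExp.nodes, unitCharge]

variable [Zero K] [Add K] [Sub K]

theorem VExp.time_unit (u : VExp) : u.time (unitCharge K) s = u.nodes := by
  induction u <;> simp_all [VExp.time, VExp.nodes, NExp.time_unit]
  all_goals simp_all [unitCharge]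

theorem BExp.time_unit (u : BExp) : u.time (unitCharge K) s = u.nodes := by
  induction u <;> simp_all [BExp.time, BExp.nodes, NExp.time_unit, VExp.time_unit]

end UnitTime

namespace Prog
open Polynomial

/-- A polynomial bound, in the size of the instance, for the running time at unit cost. In a loop,
the test takes time `6` and the increment of the counter `4`. -/
noncomputable def timePoly : Prog → ℕ[X]
  | skip => 1
  | setReg _ u => C (u.nodes + 1)
  | setNat _ i u => C (i.nodes + u.nodes + 1)
  | setVal _ i u => C (i.nodes + u.nodes + 1)
  | seq p q => p.timePoly + q.timePoly
  | branch b p q => C (b.nodes + 1) + (p.timePoly + q.timePoly)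
  | loop _ _ k p => C 8 + (X + C k) * (C 10 + p.timePoly)

/-- The loops of a well-formed program are bounded by the size of the instance, so that termination
and polynomial running time need no further argument: it halts within its time bound, in the state
computed by `run`. -/
theorem exec_compile {p : Prog} (h : p.WF) (s : State ℝ) :
    ∃ t, Exec (unitCharge ℝ) p.compile s t (p.run s) ∧
      t ≤ p.timePoly.eval (s.reg 0 + s.reg 1) := by
  induction p generalizing s with
  | skip => exact ⟨_, .skip s, by simp [timePoly]⟩
  | setReg x u => exact ⟨_, .setReg s x u, by simp [timePoly, NExp.time_unit]⟩
  | setNat a i u => exact ⟨_, .setNat s a i u, by simp [timePoly, NExp.time_unit]⟩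
  | setVal a i u =>
    exact ⟨_, .setVal s a i u, by simp [timePoly, NExp.time_unit, VExp.time_unit]⟩
  | seq p q hp hq =>
    obtain ⟨t₁, e₁, l₁⟩ := hp h.1 s
    obtain ⟨t₂, e₂, l₂⟩ := hq h.2 (p.run s)
    rw [(frame_run p s).reg 0 (h.1.not_writesReg (by norm_num)),
      (frame_run p s).reg 1 (h.1.not_writesReg (by norm_num))] at l₂
    exact ⟨_, .seq e₁ e₂, by simp only [timePoly, eval_add]; omega⟩
  | branch b p q hp hq =>
    by_cases hb : b.eval s
    · obtain ⟨t, e, l⟩ := hp h.1 s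
      refine ⟨b.time (unitCharge ℝ) s + 1 + t, ?_, ?_⟩
      · rw [run, if_pos hb]
        exact .branch_true hb e
      · simp only [timePoly, eval_add, eval_C, BExp.time_unit]
        omega
    · obtain ⟨t, e, l⟩ := hq h.2 s
      refine ⟨b.time (unitCharge ℝ) s + 1 + t, ?_, ?_⟩
      · rw [run, if_neg hb]
        exact .branch_false hb e
      · simp only [timePoly, eval_add, eval_C, BExp.time_unit]
        omega
  | loop x r k p hp =>
    obtain ⟨h1, h2, h3, h4⟩ := h
    set B := p.timePoly.eval (s.reg 0 + s.reg 1) with hB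
    have hr : ¬ p.writesReg r := h4.not_writesReg h2
    have key : ∀ N (u : State ℝ), u.reg 0 = s.reg 0 → u.reg 1 = s.reg 1 →
        u.reg x + N = s.reg r + k → ∃ t, Exec (unitCharge ℝ)
          (.loop (.nlt (.reg x) (.add (.reg r) (.lit k)))
            (.seq p.compile (.setReg x (.add (.reg x) (.lit 1))))) u t
          ((fun t => (p.run t).putReg x ((p.run t).reg x + 1))^[N] u) ∧
          t ≤ 6 + N * (10 + B) := by
      intro N
      induction N with
      | zero =>
        intro u u0 u1 hu
        have hur : u.reg r = s.reg r := by interval_cases r <;> assumption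
        refine ⟨_, .loop_false ?_, ?_⟩
        · simp only [BExp.eval, NExp.eval]; omega
        · simp [BExp.time_unit, BExp.nodes, NExp.nodes]
      | succ N ih =>
        intro u u0 u1 hu
        have hur : u.reg r = s.reg r := by interval_cases r <;> assumption
        obtain ⟨t₁, e₁, l₁⟩ := hp h4 u
        rw [u0, u1, ← hB] at l₁
        have f0 := (frame_run p u).reg 0 (h4.not_writesReg (by norm_num))
        have f1 := (frame_run p u).reg 1 (h4.not_writesReg (by norm_num))
        have fx := (frame_run p u).reg x h3
        have x0 : 0 ≠ x := by omega
        have x1 : 1 ≠ x := by omega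
        obtain ⟨t₂, e₂, l₂⟩ := ih ((p.run u).putReg x ((p.run u).reg x + 1))
          (by simp [x0, f0, u0]) (by simp [x1, f1, u1]) (by simp [fx]; omega)
        refine ⟨_, .loop_true ?_ (.seq e₁ (.setReg _ _ _)) e₂, ?_⟩
        · simp only [BExp.eval, NExp.eval]; omega
        · simp only [BExp.time_unit, NExp.time_unit, BExp.nodes, NExp.nodes, add_mul, one_mul]
          omega
    have hrx : r ≠ x := by omega
    have x0 : 0 ≠ x := by omega
    have x1 : 1 ≠ x := by omega
    obtain ⟨t, e, l⟩ := key (s.reg r + k) (s.putReg x 0) (by simp [x0]) (by simp [x1]) (by simp)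
    refine ⟨_, .seq (.setReg _ _ _) e, ?_⟩
    have hle : s.reg r + k ≤ s.reg 0 + s.reg 1 + k := by interval_cases r <;> omega
    simp only [timePoly, eval_add, eval_C, eval_mul, eval_X, NExp.time_unit, NExp.nodes, ← hB]
    have := Nat.mul_le_mul_right (10 + B) hle
    omega

end Prog

/-! ### From unit cost over the reals to logarithmic cost over the rationals -/

/-- A memory with rational numbers, seen as one with real numbers. -/
noncomputable def castState (s : State ℚ) : State ℝ :=
  ⟨s.reg, s.nat, fun a k => (s.val a k : ℝ)⟩

theorem NExp.eval_cast (s : State ℚ) (u : NExp) : u.eval (castState s) = u.eval s := by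
  induction u <;> simp_all [NExp.eval, castState]

theorem VExp.eval_cast (s : State ℚ) (u : VExp) :
    u.eval (castState s) = ((u.eval s : ℚ) : ℝ) := by
  induction u <;> simp_all [VExp.eval, NExp.eval_cast]
  simp [castState]

theorem BExp.eval_cast (s : State ℚ) (u : BExp) : u.eval (castState s) ↔ u.eval s := by
  induction u <;> simp_all [BExp.eval, NExp.eval_cast, VExp.eval_cast]

theorem putReg_cast (s : State ℚ) (x v : ℕ) :
    (castState s).putReg x v = castState (s.putReg x v) := rfl

theorem putNat_cast (s : State ℚ) (a k v : ℕ) :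
    (castState s).putNat a k v = castState (s.putNat a k v) := rfl

theorem putVal_cast (s : State ℚ) (a k : ℕ) (v : ℚ) :
    (castState s).putVal a k (v : ℝ) = castState (s.putVal a k v) := by
  ext x y
  · rfl
  · rfl
  · simp only [castState, State.putVal, Function.update_apply]
    split_ifs <;> simp [Function.update_apply, *]
    split_ifs <;> rfl

/-- The largest literal of an expression. -/
def NExp.maxLit : NExp → ℕ
  | .lit k => k
  | .reg _ => 0
  | .get _ i => i.maxLit
  | .add u v | .sub u v => max u.maxLit v.maxLit

/-- The largest literal of an expression. -/
def VExp.maxLit : VExp → ℕ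
  | .zero => 0
  | .get _ i => i.maxLit
  | .add u v | .sub u v => max u.maxLit v.maxLit

/-- The largest literal of a test. -/
def BExp.maxLit : BExp → ℕ
  | .nlt u v => max u.maxLit v.maxLit
  | .vlt u v => max u.maxLit v.maxLit
  | .neg b => b.maxLit
  | .conj b d => max b.maxLit d.maxLit

/-- The largest literal of a program. -/
def Cmd.maxLit : Cmd → ℕ
  | .skip => 0
  | .setReg _ u => u.maxLit
  | .setNat _ i u => max i.maxLit u.maxLit
  | .setVal _ i u => max i.maxLit u.maxLit
  | .seq p q => max p.maxLit q.maxLit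
  | .branch b p q => max b.maxLit (max p.maxLit q.maxLit)
  | .loop b p => max b.maxLit p.maxLit

/-- All natural numbers in memory are at most `2 ^ e`, and all rational numbers in memory have
absolute value at most `2 ^ e / D` and become integers when multiplied by `D`. -/
structure Small (D e : ℕ) (s : State ℚ) : Prop where
  reg : ∀ x, s.reg x ≤ 2 ^ e
  nat : ∀ a k, s.nat a k ≤ 2 ^ e
  val : ∀ a k, ∃ z : ℤ, s.val a k * D = z ∧ |z| ≤ 2 ^ e

theorem Small.mono {D e e' : ℕ} {s : State ℚ} (h : Small D e s) (he : e ≤ e') : Small D e' s := by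
  have h1 : 2 ^ e ≤ 2 ^ e' := Nat.pow_le_pow_right (by norm_num) he
  refine ⟨fun x => (h.reg x).trans h1, fun a k => (h.nat a k).trans h1, fun a k => ?_⟩
  obtain ⟨z, hz, hz'⟩ := h.val a k
  exact ⟨z, hz, hz'.trans (by exact_mod_cast h1)⟩

theorem two_pow_add_two_pow_le (e i j : ℕ) : 2 ^ (e + i) + 2 ^ (e + j) ≤ 2 ^ (e + (i + j + 1)) := by
  have h1 : 2 ^ (e + i) ≤ 2 ^ (e + (i + j)) := Nat.pow_le_pow_right (by norm_num) (by omega)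
  have h2 : 2 ^ (e + j) ≤ 2 ^ (e + (i + j)) := Nat.pow_le_pow_right (by norm_num) (by omega)
  have : 2 ^ (e + (i + j + 1)) = 2 * 2 ^ (e + (i + j)) := by ring
  omega

section
variable {D e : ℕ} {s : State ℚ}

theorem NExp.eval_le_two_pow (hs : Small D e s) (u : NExp) (hu : u.maxLit ≤ 2 ^ e) :
    u.eval s ≤ 2 ^ (e + u.nodes) := by
  have hmono : ∀ j, 2 ^ e ≤ 2 ^ (e + j) := fun j => Nat.pow_le_pow_right (by norm_num) (by omega)
  induction u with
  | lit k => exact le_trans hu (hmono _)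
  | reg x => exact (hs.reg x).trans (hmono _)
  | get a i => exact (hs.nat _ _).trans (hmono _)
  | add u v hu' hv' =>
    simp only [maxLit, max_le_iff] at hu
    exact (add_le_add (hu' hu.1) (hv' hu.2)).trans (two_pow_add_two_pow_le _ _ _)
  | sub u v hu' hv' =>
    simp only [maxLit, max_le_iff] at hu
    refine (Nat.sub_le _ _).trans ((hu' hu.1).trans ?_)
    exact Nat.pow_le_pow_right (by norm_num) (by simp only [nodes]; omega)

theorem VExp.eval_small (hs : Small D e s) (u : VExp) :
    ∃ z : ℤ, u.eval s * D = z ∧ |z| ≤ 2 ^ (e + u.nodes) := by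
  have hmono : ∀ j, (2 : ℤ) ^ e ≤ 2 ^ (e + j) := fun j =>
    pow_le_pow_right₀ (by norm_num) (by omega)
  induction u with
  | zero => exact ⟨0, by simp [eval], by simp⟩
  | get a i =>
    obtain ⟨z, h1, h2⟩ := hs.val a (i.eval s)
    exact ⟨z, h1, h2.trans (hmono _)⟩
  | add u v hu hv =>
    obtain ⟨y, h1, h2⟩ := hu
    obtain ⟨z, h3, h4⟩ := hv
    refine ⟨y + z, by push_cast; rw [← h1, ← h3, eval]; ring, ?_⟩
    refine (abs_add_le y z).trans ((add_le_add h2 h4).trans ?_)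
    exact_mod_cast two_pow_add_two_pow_le e u.nodes v.nodes
  | sub u v hu hv =>
    obtain ⟨y, h1, h2⟩ := hu
    obtain ⟨z, h3, h4⟩ := hv
    refine ⟨y - z, by push_cast; rw [← h1, ← h3, eval]; ring, ?_⟩
    refine (abs_sub y z).trans ((add_le_add h2 h4).trans ?_)
    exact_mod_cast two_pow_add_two_pow_le e u.nodes v.nodes

theorem size_le_of_le_two_pow {x T : ℕ} (h : x ≤ 2 ^ T) : Nat.size x ≤ T + 1 :=
  Nat.size_le.2 (h.trans_lt (Nat.pow_lt_pow_right (by norm_num) (by omega)))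

theorem ratBits_le {q : ℚ} {z : ℤ} {T : ℕ} (hD : 0 < D) (h : q * D = z) (hz : |z| ≤ 2 ^ T) :
    ratBits q ≤ T + Nat.size D + 2 := by
  have hq : q = Rat.divInt z D := by
    rw [Rat.divInt_eq_div, eq_div_iff (by positivity)]
    exact_mod_cast h
  have hden : q.den ≤ D := by
    refine Nat.le_of_dvd hD ?_
    have := Rat.den_dvd z D
    rw [← hq] at this
    exact_mod_cast this
  have hnum : q.num.natAbs ≤ 2 ^ T := by
    have h1 : q.num.natAbs ≤ z.natAbs := by
      rcases eq_or_ne z 0 with rfl | hz0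
      · simp [hq]
      · refine Nat.le_of_dvd (Int.natAbs_pos.2 hz0) (Int.natAbs_dvd_natAbs.2 ?_)
        rw [hq]
        exact Rat.num_dvd z (by exact_mod_cast hD.ne')
    have h2 : z.natAbs ≤ 2 ^ T := by zify; exact hz
    exact h1.trans h2
  have h1 := Nat.size_le_size hden
  have h2 := size_le_of_le_two_pow hnum
  simp only [ratBits]
  omega

variable {T : ℕ}

theorem NExp.size_eval_le (hs : Small D e s) (u : NExp) (hu : u.maxLit ≤ 2 ^ e)
    (hT : e + u.nodes ≤ T) : Nat.size (u.eval s) ≤ T + Nat.size D + 2 :=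
  (size_le_of_le_two_pow ((u.eval_le_two_pow hs hu).trans
    (Nat.pow_le_pow_right (by norm_num) hT))).trans (by omega)

theorem VExp.ratBits_eval_le (hD : 0 < D) (hs : Small D e s) (u : VExp)
    (hT : e + u.nodes ≤ T) : ratBits (u.eval s) ≤ T + Nat.size D + 2 := by
  obtain ⟨z, h1, h2⟩ := u.eval_small hs
  exact ratBits_le hD h1 (h2.trans (pow_le_pow_right₀ (by norm_num) hT))

theorem NExp.time_bit_le (hs : Small D e s) (u : NExp) (hu : u.maxLit ≤ 2 ^ e)
    (hT : e + u.nodes ≤ T) : u.time bitCharge s ≤ u.nodes * (T + Nat.size D + 3) := by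
  have hw := u.size_eval_le hs hu hT
  induction u with
  | lit k | reg x => simp only [time, nodes, bitCharge, eval] at *; omega
  | get a i ih =>
    have h1 := ih hu (by simp only [nodes] at hT; omega)
      (i.size_eval_le hs hu (by simp only [nodes] at hT; omega))
    simp only [time, nodes, bitCharge, add_mul] at *
    omega
  | add u v hu' hv' | sub u v hu' hv' =>
    simp only [maxLit, max_le_iff] at hu
    simp only [nodes] at hT
    have h1 := hu' hu.1 (by omega) (u.size_eval_le hs hu.1 (by omega))
    have h2 := hv' hu.2 (by omega) (v.size_eval_le hs hu.2 (by omega))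
    simp only [time, nodes, bitCharge, add_mul] at *
    omega

theorem VExp.time_bit_le (hD : 0 < D) (hs : Small D e s) (u : VExp) (hu : u.maxLit ≤ 2 ^ e)
    (hT : e + u.nodes ≤ T) : u.time bitCharge s ≤ u.nodes * (T + Nat.size D + 3) := by
  have hw := u.ratBits_eval_le hD hs hT
  induction u with
  | zero => simp only [time, nodes, bitCharge, eval] at *; omega
  | get a i =>
    have h1 := i.time_bit_le hs hu (T := T) (by simp only [nodes] at hT; omega)
    simp only [time, nodes, add_mul] at *
    simp only [bitCharge] at *
    omega
  | add u v hu' hv' | sub u v hu' hv' =>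
    simp only [maxLit, max_le_iff] at hu
    simp only [nodes] at hT
    have h1 := hu' hu.1 (by omega) (u.ratBits_eval_le hD hs (by omega))
    have h2 := hv' hu.2 (by omega) (v.ratBits_eval_le hD hs (by omega))
    simp only [time, nodes, add_mul] at *
    simp only [bitCharge] at *
    omega

theorem BExp.time_bit_le (hD : 0 < D) (hs : Small D e s) (u : BExp) (hu : u.maxLit ≤ 2 ^ e)
    (hT : e + u.nodes ≤ T) : u.time bitCharge s ≤ u.nodes * (T + Nat.size D + 3) := by
  induction u with
  | nlt u v =>
    simp only [maxLit, max_le_iff] at hu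
    simp only [nodes] at hT
    have h1 := u.time_bit_le hs hu.1 (T := T) (by omega)
    have h2 := v.time_bit_le hs hu.2 (T := T) (by omega)
    simp only [time, nodes, add_mul]
    omega
  | vlt u v =>
    simp only [maxLit, max_le_iff] at hu
    simp only [nodes] at hT
    have h1 := u.time_bit_le hD hs hu.1 (T := T) (by omega)
    have h2 := v.time_bit_le hD hs hu.2 (T := T) (by omega)
    simp only [time, nodes, add_mul]
    omega
  | neg b hb =>
    simp only [nodes] at hT
    have h1 := hb hu (by omega)
    simp only [time, nodes, add_mul]
    omega
  | conj b d hb hd =>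
    simp only [maxLit, max_le_iff] at hu
    simp only [nodes] at hT
    have h1 := hb hu.1 (by omega)
    have h2 := hd hu.2 (by omega)
    simp only [time, nodes, add_mul]
    omega

theorem Small.putReg {e' : ℕ} (hs : Small D e s) (he : e ≤ e') {v : ℕ} (x : ℕ)
    (hv : v ≤ 2 ^ e') : Small D e' (s.putReg x v) := by
  refine ⟨fun y => ?_, (hs.mono he).nat, (hs.mono he).val⟩
  rw [putReg_reg]
  split_ifs
  exacts [hv, (hs.mono he).reg y]

theorem Small.putNat {e' : ℕ} (hs : Small D e s) (he : e ≤ e') {v : ℕ} (a k : ℕ)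
    (hv : v ≤ 2 ^ e') : Small D e' (s.putNat a k v) := by
  refine ⟨(hs.mono he).reg, fun b j => ?_, (hs.mono he).val⟩
  rw [putNat_nat]
  split_ifs
  · rw [Function.update_apply]
    split_ifs
    exacts [hv, (hs.mono he).nat a j]
  · exact (hs.mono he).nat b j

theorem Small.putVal {e' : ℕ} (hs : Small D e s) (he : e ≤ e') {v : ℚ} (a k : ℕ)
    (hv : ∃ z : ℤ, v * D = z ∧ |z| ≤ 2 ^ e') : Small D e' (s.putVal a k v) := by
  refine ⟨(hs.mono he).reg, (hs.mono he).nat, fun b j => ?_⟩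
  rw [putVal_val]
  split_ifs
  · rw [Function.update_apply]
    split_ifs
    exacts [hv, (hs.mono he).val a j]
  · exact (hs.mono he).val b j

end

/-- A computation on real numbers that starts with rational numbers is a computation on rational
numbers. If it takes `t` operations, its logarithmic cost is at most `t` times a linear function of
`t`, of the binary length of a common denominator `D` of the rational numbers in the initial memory,
and of the length `e` of the natural numbers and numerators there: there is no multiplication, so
that `D` remains a common denominator and numerators at most double in a unit of time. -/
theorem Exec.bitCharge_of_unitCharge {D T : ℕ} (hD : 0 < D) {P : Cmd} {S S' : State ℝ} {t : ℕ}
    (h : Exec (unitCharge ℝ) P S t S') :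
    ∀ (s : State ℚ) (e : ℕ), S = castState s → Small D e s → P.maxLit ≤ 2 ^ e → e + t ≤ T →
      ∃ (t' : ℕ) (s' : State ℚ), Exec bitCharge P s t' s' ∧ S' = castState s' ∧
        t' ≤ t * (T + Nat.size D + 3) ∧ Small D (e + t) s' := by
  have hpow : ∀ {e e' : ℕ}, e ≤ e' → 2 ^ e ≤ 2 ^ e' := fun h => Nat.pow_le_pow_right (by norm_num) h
  induction h with
  | skip S =>
    rintro s e rfl hs - -
    exact ⟨1, s, .skip s, rfl, by omega, hs.mono (by omega)⟩
  | setReg S x u =>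
    rintro s e rfl hs hl hT
    rw [NExp.time_unit] at *
    have h1 := u.time_bit_le hs hl (T := T) (by omega)
    refine ⟨_, _, .setReg s x u, by rw [NExp.eval_cast, putReg_cast], ?_, ?_⟩
    · rw [add_mul]; omega
    · exact hs.putReg (by omega) x ((u.eval_le_two_pow hs hl).trans (hpow (by omega)))
  | setNat S a i u =>
    rintro s e rfl hs hl hT
    rw [NExp.time_unit, NExp.time_unit] at *
    simp only [Cmd.maxLit, max_le_iff] at hl
    have h1 := u.time_bit_le hs hl.2 (T := T) (by omega)
    have h2 := i.time_bit_le hs hl.1 (T := T) (by omega)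
    refine ⟨_, _, .setNat s a i u, by rw [NExp.eval_cast, NExp.eval_cast, putNat_cast], ?_, ?_⟩
    · rw [add_mul, add_mul]; omega
    · exact hs.putNat (by omega) a _ ((u.eval_le_two_pow hs hl.2).trans (hpow (by omega)))
  | setVal S a i u =>
    rintro s e rfl hs hl hT
    rw [NExp.time_unit, VExp.time_unit] at *
    simp only [Cmd.maxLit, max_le_iff] at hl
    have h1 := u.time_bit_le hD hs hl.2 (T := T) (by omega)
    have h2 := i.time_bit_le hs hl.1 (T := T) (by omega)
    refine ⟨_, _, .setVal s a i u, by rw [NExp.eval_cast, VExp.eval_cast, putVal_cast], ?_, ?_⟩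
    · rw [add_mul, add_mul]; omega
    · obtain ⟨z, hz, hz'⟩ := u.eval_small hs
      exact hs.putVal (by omega) a _
        ⟨z, hz, hz'.trans (pow_le_pow_right₀ (by norm_num) (by omega))⟩
  | seq _ _ ih₁ ih₂ =>
    rintro s e rfl hs hl hT
    simp only [Cmd.maxLit, max_le_iff] at hl
    obtain ⟨t₁', s₁, x₁, rfl, l₁, m₁⟩ := ih₁ s e rfl hs hl.1 (by omega)
    obtain ⟨t₂', s₂, x₂, rfl, l₂, m₂⟩ := ih₂ s₁ _ rfl m₁ (hl.2.trans (hpow (by omega))) (by omega)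
    refine ⟨_, s₂, .seq x₁ x₂, rfl, ?_, m₂.mono (by omega)⟩
    rw [add_mul]; omega
  | @branch_true b _ _ _ _ _ hb _ ih =>
    rintro s e rfl hs hl hT
    simp only [Cmd.maxLit, max_le_iff] at hl
    rw [BExp.time_unit] at *
    have h1 := b.time_bit_le hD hs hl.1 (T := T) (by omega)
    obtain ⟨t', s', x, rfl, l, m⟩ := ih s e rfl hs hl.2.1 (by omega)
    refine ⟨_, s', .branch_true ((b.eval_cast s).1 hb) x, rfl, ?_, m.mono (by omega)⟩
    rw [add_mul, add_mul]; omega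
  | @branch_false b _ _ _ _ _ hb _ ih =>
    rintro s e rfl hs hl hT
    simp only [Cmd.maxLit, max_le_iff] at hl
    rw [BExp.time_unit] at *
    have h1 := b.time_bit_le hD hs hl.1 (T := T) (by omega)
    obtain ⟨t', s', x, rfl, l, m⟩ := ih s e rfl hs hl.2.2 (by omega)
    refine ⟨_, s', .branch_false (mt (b.eval_cast s).2 hb) x, rfl, ?_, m.mono (by omega)⟩
    rw [add_mul, add_mul]; omega
  | @loop_true b _ _ _ _ _ _ hb _ _ ih₁ ih₂ =>
    rintro s e rfl hs hl hT
    rw [BExp.time_unit] at *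
    have hl' := max_le_iff.1 hl
    have h1 := b.time_bit_le hD hs hl'.1 (T := T) (by omega)
    obtain ⟨t₁', s₁, x₁, rfl, l₁, m₁⟩ := ih₁ s e rfl hs hl'.2 (by omega)
    obtain ⟨t₂', s₂, x₂, rfl, l₂, m₂⟩ := ih₂ s₁ _ rfl m₁ (hl.trans (hpow (by omega))) (by omega)
    refine ⟨_, s₂, .loop_true ((b.eval_cast s).1 hb) x₁ x₂, rfl, ?_, m₂.mono (by omega)⟩
    rw [add_mul, add_mul, add_mul]; omega
  | @loop_false b _ _ hb =>
    rintro s e rfl hs hl hT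
    rw [BExp.time_unit] at *
    have h1 := b.time_bit_le hD hs (max_le_iff.1 hl).1 (T := T) (by omega)
    refine ⟨_, s, .loop_false (mt (b.eval_cast s).2 hb), rfl, ?_, hs.mono (by omega)⟩
    rw [add_mul]; omega

/-- The product of the denominators of the costs. -/
def commonDen {n m : ℕ} (c : Fin n → Fin m → ℚ) : ℕ := ∏ i, ∏ e, (c i e).den

theorem commonDen_pos {n m : ℕ} (c : Fin n → Fin m → ℚ) : 0 < commonDen c :=
  Finset.prod_pos fun i _ => Finset.prod_pos fun e _ => (c i e).den_pos

theorem commonDen_le {n m : ℕ} (c : Fin n → Fin m → ℚ) :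
    commonDen c ≤ 2 ^ (∑ i, ∑ e, Nat.size (c i e).den) := by
  rw [← Finset.prod_pow_eq_pow_sum]
  refine Finset.prod_le_prod' fun i _ => ?_
  rw [← Finset.prod_pow_eq_pow_sum]
  exact Finset.prod_le_prod' fun e _ => (Nat.lt_size_self _).le

theorem small_inputState {n m : ℕ} (c : Fin n → Fin m → ℚ) {L : ℕ} (hL : inputBits c ≤ L) :
    Small (commonDen c) L (inputState c) := by
  have hpow : ∀ {e : ℕ}, e ≤ L → 2 ^ e ≤ 2 ^ L := fun h => Nat.pow_le_pow_right (by norm_num) h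
  have hn : n ≤ 2 ^ L := Nat.lt_two_pow_self.le.trans (hpow (by unfold inputBits at hL; omega))
  have hm : m ≤ 2 ^ L := Nat.lt_two_pow_self.le.trans (hpow (by unfold inputBits at hL; omega))
  refine ⟨fun x => ?_, fun a k => by simp [inputState], fun a k => ?_⟩
  · simp only [inputState]
    split_ifs
    exacts [hn, hm, Nat.zero_le _]
  · simp only [inputState]
    split_ifs
    · generalize (⟨k / m, _⟩ : Fin n) = i
      generalize (⟨k % m, _⟩ : Fin m) = e
      obtain ⟨d, hd⟩ : (c i e).den ∣ commonDen c :=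
        (Finset.dvd_prod_of_mem (fun e => (c i e).den) (Finset.mem_univ e)).trans
          (Finset.dvd_prod_of_mem (fun i => ∏ e, (c i e).den) (Finset.mem_univ i))
      refine ⟨(c i e).num * d, ?_, ?_⟩
      · rw [hd]
        push_cast
        rw [← mul_assoc, Rat.mul_den_eq_num]
      · have h1 : d ≤ commonDen c := by
          rw [hd]
          exact Nat.le_mul_of_pos_left _ (c i e).den_pos
        have h2 : ((c i e).num * d).natAbs ≤ 2 ^ L := by
          rw [Int.natAbs_mul, Int.natAbs_natCast]
          refine (Nat.mul_le_mul (Nat.lt_size_self _).le (h1.trans (commonDen_le c))).trans ?_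
          rw [← pow_add]
          refine hpow (le_trans ?_ hL)
          have h3 : Nat.size (c i e).num.natAbs ≤ ∑ i, ∑ e, Nat.size (c i e).num.natAbs :=
            (Finset.single_le_sum (f := fun e => Nat.size (c i e).num.natAbs)
              (fun _ _ => Nat.zero_le _) (Finset.mem_univ e)).trans
              (Finset.single_le_sum (f := fun i => ∑ e, Nat.size (c i e).num.natAbs)
                (fun _ _ => Nat.zero_le _) (Finset.mem_univ i))
          have h4 : ∑ i, ∑ e, ratBits (c i e) = ∑ i : Fin n, ∑ e : Fin m, 1 +
              ∑ i, ∑ e, Nat.size (c i e).num.natAbs + ∑ i, ∑ e, Nat.size (c i e).den := by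
            simp only [ratBits, Finset.sum_add_distrib]
          unfold inputBits
          omega
        zify at h2
        exact h2
    · exact ⟨0, by simp, by simp⟩

theorem castState_inputState {n m : ℕ} (c : Fin n → Fin m → ℚ) :
    castState (inputState c) = inputState fun i e => (c i e : ℝ) := by
  ext x y
  · rfl
  · rfl
  · simp only [castState, inputState]
    split_ifs <;> simp

theorem eval_nat_mono (p : Polynomial ℕ) {x y : ℕ} (h : x ≤ y) : p.eval x ≤ p.eval y := by
  simp only [Polynomial.eval_eq_sum_range]
  gcongr

open Polynomial in
/-- A program that runs in polynomial time at unit cost on rational inputs, regarded as real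
ones, runs in polynomial time at logarithmic cost. -/
theorem exists_poly_bitCharge (P : Cmd) (p : ℕ[X]) : ∃ q : ℕ[X], ∀ (n m : ℕ)
    (c : Fin n → Fin m → ℚ) (t : ℕ) (S : State ℝ),
    Exec (unitCharge ℝ) P (inputState fun i e => (c i e : ℝ)) t S → t ≤ p.eval (n + m) →
    ∃ (t' : ℕ) (s : State ℚ), Exec bitCharge P (inputState c) t' s ∧
      t' ≤ q.eval (inputBits c) ∧ S = castState s := by
  refine ⟨p * (p + C 2 * X + C (P.maxLit + 4)), fun n m c t S h ht => ?_⟩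
  set B := inputBits c with hB
  have ht' : t ≤ p.eval B := ht.trans (eval_nat_mono p (by simp [hB, inputBits]))
  have hL : P.maxLit ≤ 2 ^ (B + P.maxLit) :=
    Nat.lt_two_pow_self.le.trans (Nat.pow_le_pow_right (by norm_num) (by omega))
  obtain ⟨t', s, hx, hS, hle, -⟩ := h.bitCharge_of_unitCharge (commonDen_pos c) (inputState c)
    (B + P.maxLit) (castState_inputState c).symm (small_inputState c (by omega)) hL le_rfl
  refine ⟨t', s, hx, hle.trans ?_, hS⟩
  have hD : Nat.size (commonDen c) ≤ B + 1 := by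
    refine size_le_of_le_two_pow ((commonDen_le c).trans (Nat.pow_le_pow_right (by norm_num) ?_))
    refine le_trans ?_ (Nat.le_add_left _ _)
    exact Finset.sum_le_sum fun i _ => Finset.sum_le_sum fun e _ => by
      simp only [ratBits]; omega
  simp only [eval_mul, eval_add, eval_C, eval_X]
  exact Nat.mul_le_mul ht' (by omega)

/-! ### Fair schedules for items of common cost -/

/-- The total cost of those among the first `m` items that `a` sends to machine `i`. -/
noncomputable def load (d : ℕ → ℝ) (m : ℕ) (a : ℕ → ℕ) (i : ℕ) : ℝ :=
  ∑ e ∈ Finset.range m, if a e = i then d e else 0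

/-- The first `m` items go to the first `n` machines. -/
def Valid (n m : ℕ) (a : ℕ → ℕ) : Prop := ∀ e < m, a e < n

/-- Envy-freeness up to one item for agents with common costs. -/
def Fair (n m : ℕ) (d : ℕ → ℝ) (a : ℕ → ℕ) : Prop :=
  ∀ i < n, ∀ j < n, load d m a i ≤ load d m a j ∨
    ∃ w < m, a w = i ∧ load d m a i - d w ≤ load d m a j

section
variable {n m : ℕ} {d : ℕ → ℝ} {a b : ℕ → ℕ}

theorem load_nonneg (hd : ∀ e < m, 0 ≤ d e) (a : ℕ → ℕ) (i : ℕ) : 0 ≤ load d m a i :=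
  Finset.sum_nonneg fun e he => by
    split_ifs
    exacts [hd e (Finset.mem_range.1 he), le_rfl]

theorem le_load (hd : ∀ e < m, 0 ≤ d e) (a : ℕ → ℕ) {e : ℕ} (he : e < m) :
    d e ≤ load d m a (a e) := by
  have := Finset.single_le_sum (f := fun e' => if a e' = a e then d e' else 0)
    (fun e' he' => by
      split_ifs
      exacts [hd e' (Finset.mem_range.1 he'), le_rfl]) (Finset.mem_range.2 he)
  simpa [load] using this

theorem load_congr {d' : ℕ → ℝ} (h : ∀ e < m, a e = b e ∧ d e = d' e) (i : ℕ) :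
    load d m a i = load d' m b i :=
  Finset.sum_congr rfl fun e he => by
    rw [(h e (Finset.mem_range.1 he)).1, (h e (Finset.mem_range.1 he)).2]

theorem sum_load (ha : Valid n m a) :
    ∑ i ∈ Finset.range n, load d m a i = ∑ e ∈ Finset.range m, d e := by
  unfold load
  rw [Finset.sum_comm]
  refine Finset.sum_congr rfl fun e he => ?_
  rw [Finset.sum_ite_eq, if_pos (Finset.mem_range.2 (ha e (Finset.mem_range.1 he)))]

/-- Some machine has at most the average load, which no schedule beats. -/
theorem exists_load_le (hn : 0 < n) (ha : Valid n m a) (hb : Valid n m b) {B : ℝ}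
    (hB : ∀ i < n, load d m b i ≤ B) : ∃ j < n, load d m a j ≤ B := by
  by_contra! h
  have h1 : ∑ i ∈ Finset.range n, load d m b i < ∑ i ∈ Finset.range n, load d m a i :=
    Finset.sum_lt_sum_of_nonempty ⟨0, Finset.mem_range.2 hn⟩ fun i hi =>
      (hB i (Finset.mem_range.1 hi)).trans_lt (h i (Finset.mem_range.1 hi))
  rw [sum_load ha, sum_load hb] at h1
  exact h1.false

theorem item_le (hd : ∀ e < m, 0 ≤ d e) (hb : Valid n m b) {B : ℝ}
    (hB : ∀ i < n, load d m b i ≤ B) {e : ℕ} (he : e < m) : d e ≤ B :=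
  (le_load hd b he).trans (hB _ (hb e he))

/-- A fair schedule is optimal up to a factor of `2`. -/
theorem Fair.load_le (hn : 0 < n) (hd : ∀ e < m, 0 ≤ d e) (ha : Valid n m a)
    (hf : Fair n m d a) (hb : Valid n m b) {B : ℝ} (hB : ∀ i < n, load d m b i ≤ B) {i : ℕ}
    (hi : i < n) : load d m a i ≤ 2 * B := by
  obtain ⟨j, hj, hjB⟩ := exists_load_le hn ha hb hB
  have hB0 : 0 ≤ B := (load_nonneg hd b 0).trans (hB 0 hn)
  rcases hf i hi j hj with h | ⟨w, hw, -, h⟩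
  · linarith
  · have := item_le hd hb hB hw
    linarith

theorem load_update {e : ℕ} (he : e < m) (j i : ℕ) :
    load d m (Function.update a e j) i =
      load d m a i - (if a e = i then d e else 0) + (if j = i then d e else 0) := by
  unfold load
  rw [← Finset.add_sum_erase _ _ (Finset.mem_range.2 he),
    ← Finset.add_sum_erase (a := e) (f := fun e => if a e = i then d e else 0) _
      (Finset.mem_range.2 he)]
  have : ∑ x ∈ (Finset.range m).erase e, (if Function.update a e j x = i then d x else 0) =
      ∑ x ∈ (Finset.range m).erase e, if a x = i then d x else 0 :=
    Finset.sum_congr rfl fun x hx => by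
      rw [Function.update_of_ne (Finset.ne_of_mem_erase hx)]
  rw [this, Function.update_self]
  ring

/-- The situation after the items below `t` that satisfy `E` have been offered to the least loaded
machine, starting with the schedule `a₀`: no load exceeds the former makespan, and a machine that
holds one of these items is least loaded without a suitable one of them. -/
structure PassInv (n m : ℕ) (d : ℕ → ℝ) (E : ℕ → Prop) (a₀ : ℕ → ℕ) (t : ℕ) (a : ℕ → ℕ) :
    Prop where
  valid : Valid n m a
  keep : ∀ e, ¬ E e → a e = a₀ e
  load_le : ∀ M, (∀ i < n, load d m a₀ i ≤ M) → ∀ i < n, load d m a i ≤ M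
  witness : ∀ i < n, (∃ e < t, E e ∧ a e = i) →
    ∃ w < t, E w ∧ a w = i ∧ ∀ j < n, load d m a i - d w ≤ load d m a j

variable {E : ℕ → Prop} {a₀ : ℕ → ℕ} {t : ℕ}

theorem PassInv.init (ha : Valid n m a) : PassInv n m d E a 0 a :=
  ⟨ha, fun _ _ => rfl, fun _ h => h, fun _ _ ⟨_, h, _⟩ => absurd h (Nat.not_lt_zero _)⟩

theorem PassInv.skip (h : PassInv n m d E a₀ t a) (ht : ¬ E t) : PassInv n m d E a₀ (t + 1) a := by
  refine ⟨h.valid, h.keep, h.load_le, ?_⟩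
  rintro i hi ⟨e, he, hE, hae⟩
  have het : e ≠ t := by rintro rfl; exact ht hE
  obtain ⟨w, hw, h'⟩ := h.witness i hi ⟨e, by omega, hE, hae⟩
  exact ⟨w, by omega, h'⟩

theorem PassInv.stay (h : PassInv n m d E a₀ t a) (hE : E t) {j : ℕ}
    (hmin : ∀ i < n, load d m a j ≤ load d m a i)
    (hle : ¬ load d m a j < load d m a (a t) - d t) : PassInv n m d E a₀ (t + 1) a := by
  refine ⟨h.valid, h.keep, h.load_le, ?_⟩
  rintro i hi ⟨e, he, hEe, hae⟩
  rcases Nat.lt_succ_iff_lt_or_eq.1 he with he | rfl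
  · obtain ⟨w, hw, h'⟩ := h.witness i hi ⟨e, he, hEe, hae⟩
    exact ⟨w, by omega, h'⟩
  · refine ⟨e, by omega, hE, hae, fun l hl => ?_⟩
    rw [← hae]
    exact (not_lt.1 hle).trans (hmin l hl)

theorem PassInv.move (h : PassInv n m d E a₀ t a) (htm : t < m) (hd : 0 ≤ d t) (hE : E t) {j : ℕ}
    (hj : j < n) (hmin : ∀ i < n, load d m a j ≤ load d m a i)
    (hlt : load d m a j < load d m a (a t) - d t) :
    PassInv n m d E a₀ (t + 1) (Function.update a t j) := by
  have hne : a t ≠ j := by rintro rfl; linarith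
  have hj' : load d m (Function.update a t j) j = load d m a j + d t := by
    rw [load_update htm, if_neg hne, if_pos rfl]; ring
  have hat : load d m (Function.update a t j) (a t) = load d m a (a t) - d t := by
    rw [load_update htm, if_pos rfl, if_neg hne.symm]; ring
  have hother : ∀ i, i ≠ j → i ≠ a t →
      load d m (Function.update a t j) i = load d m a i := fun i h1 h2 => by
    rw [load_update htm, if_neg h2.symm, if_neg h1.symm]; ring
  -- The smallest load does not decrease.
  have hmin' : ∀ i < n, load d m a j ≤ load d m (Function.update a t j) i := by
    intro i hi
    rcases eq_or_ne i j with rfl | h1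
    · rw [hj']; linarith
    rcases eq_or_ne i (a t) with rfl | h2
    · rw [hat]; exact hlt.le
    · rw [hother i h1 h2]; exact hmin i hi
  refine ⟨fun e he => ?_, fun e he => ?_, fun M hM i hi => ?_, ?_⟩
  · rw [Function.update_apply]
    split_ifs
    exacts [hj, h.valid e he]
  · have : e ≠ t := by rintro rfl; exact he hE
    rw [Function.update_of_ne this, h.keep e he]
  · have h3 := h.load_le M hM (a t) (h.valid t htm)
    rcases eq_or_ne i j with rfl | h1
    · rw [hj']; linarith
    rcases eq_or_ne i (a t) with rfl | h2
    · rw [hat]; linarith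
    · rw [hother i h1 h2]; exact h.load_le M hM i hi
  · rintro i hi ⟨e, he, hEe, hae⟩
    rcases eq_or_ne i j with rfl | h1
    · refine ⟨t, by omega, hE, by simp, fun l hl => ?_⟩
      rw [hj', add_sub_cancel_right]
      exact hmin' l hl
    · have het : e ≠ t := by rintro rfl; rw [Function.update_self] at hae; exact h1 hae.symm
      rw [Function.update_of_ne het] at hae
      obtain ⟨w, hw, hEw, haw, hw'⟩ := h.witness i hi ⟨e, by omega, hEe, hae⟩
      refine ⟨w, by omega, hEw, by rwa [Function.update_of_ne hw.ne], fun l hl => ?_⟩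
      have h2 : load d m (Function.update a t j) i ≤ load d m a i := by
        rcases eq_or_ne i (a t) with rfl | h2
        · rw [hat]; linarith
        · rw [hother i h1 h2]
      have h3 := hw' j hj
      have h4 := hmin' l hl
      linarith

/-- A pass over all items makes a schedule fair. -/
theorem PassInv.fair (hd : ∀ e < m, 0 ≤ d e) (h : PassInv n m d E a₀ m a) (hE : ∀ e < m, E e) :
    Fair n m d a := by
  intro i hi j hj
  by_cases hex : ∃ e < m, E e ∧ a e = i
  · obtain ⟨w, hw, -, haw, hw'⟩ := h.witness i hi hex
    exact Or.inr ⟨w, hw, haw, hw' j hj⟩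
  · left
    have : load d m a i = 0 := Finset.sum_eq_zero fun e he => by
      rw [if_neg]
      exact fun hae => hex ⟨e, Finset.mem_range.1 he, hE e (Finset.mem_range.1 he), hae⟩
    rw [this]
    exact load_nonneg hd a j

/-- A pass over the items that satisfy `E`, each of cost at most `δ`, makes all loads at most
`B + δ`, provided that the other items alone meet that bound. -/
theorem PassInv.load_le_add (hn : 0 < n) (h : PassInv n m d E a₀ m a)
    (hb : Valid n m b) {B δ : ℝ} (hB : ∀ i < n, load d m b i ≤ B) (hδ : ∀ e < m, E e → d e ≤ δ)
    (hlarge : ∀ i < n, (∀ e < m, a e = i → ¬ E e) → load d m a i ≤ B + δ)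
    {i : ℕ} (hi : i < n) : load d m a i ≤ B + δ := by
  by_cases hex : ∃ e < m, E e ∧ a e = i
  · obtain ⟨w, hw, hEw, -, hw'⟩ := h.witness i hi hex
    obtain ⟨j, hj, hjB⟩ := exists_load_le hn h.valid hb hB
    have h1 := hw' j hj
    have h2 := hδ w hw hEw
    linarith
  · exact hlarge i hi fun e he hae hE => hex ⟨e, he, hE, hae⟩

end

/-! ### Rounding the costs -/

/-- How often the class `s` occurs on machine `i` in the schedule `a`. -/
def classCount (cls : ℕ → ℕ) (m : ℕ) (a : ℕ → ℕ) (s i : ℕ) : ℕ :=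
  ((Finset.range m).filter fun e => cls e = s ∧ a e = i).card

/-- `cls` rounds costs down to multiples of `G / K`, for costs up to `G`. -/
structure Rounds (m : ℕ) (d : ℕ → ℝ) (G : ℝ) (K : ℕ) (cls : ℕ → ℕ) : Prop where
  le : ∀ e < m, cls e ≤ K
  lower : ∀ e < m, cls e * G ≤ K * d e
  upper : ∀ e < m, K * d e ≤ (cls e + 1) * G

section
variable {n m k K : ℕ} {d : ℕ → ℝ} {a b cls : ℕ → ℕ} {G B : ℝ}

/-- The total class of the large items on a machine depends on the class counts only. -/
theorem sum_class_eq (hcls : ∀ e < m, cls e ≤ K) (a : ℕ → ℕ) (i : ℕ) :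
    ∑ e ∈ Finset.range m, (if a e = i ∧ k ≤ cls e then cls e else 0) =
      ∑ s ∈ Finset.range (K + 1), if k ≤ s then s * classCount cls m a s i else 0 := by
  have h1 : ∀ s ∈ Finset.range (K + 1), (if k ≤ s then s * classCount cls m a s i else 0) =
      ∑ e ∈ Finset.range m,
        if cls e = s then (if a e = i ∧ k ≤ cls e then cls e else 0) else 0 := by
    intro s _
    rw [classCount, Finset.card_filter]
    split_ifs with hs
    · rw [Finset.mul_sum]
      refine Finset.sum_congr rfl fun e _ => ?_
      by_cases h1 : cls e = s <;> by_cases h2 : a e = i <;> simp [h1, h2, hs]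
    · symm
      refine Finset.sum_eq_zero fun e _ => ?_
      by_cases h1 : cls e = s
      · simp [h1, hs]
      · simp [h1]
  rw [Finset.sum_congr rfl h1, Finset.sum_comm]
  refine Finset.sum_congr rfl fun e he => ?_
  rw [Finset.sum_ite_eq,
    if_pos (Finset.mem_range.2 (Nat.lt_succ_of_le (hcls e (Finset.mem_range.1 he))))]

/-- Rounding: the large items on machine `i` have total class at most `K * B / G`. -/
theorem sum_class_mul_le (hd : ∀ e < m, 0 ≤ d e) (hr : Rounds m d G K cls)
    {i : ℕ} (hb : load d m b i ≤ B) :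
    ((∑ e ∈ Finset.range m, if b e = i ∧ k ≤ cls e then cls e else 0 : ℕ) : ℝ) * G ≤ K * B := by
  refine le_trans ?_ (mul_le_mul_of_nonneg_left hb (Nat.cast_nonneg K))
  rw [load, Finset.mul_sum]
  push_cast
  rw [Finset.sum_mul]
  refine Finset.sum_le_sum fun e he => ?_
  have he := Finset.mem_range.1 he
  have h0 : 0 ≤ (K : ℝ) * d e := mul_nonneg (Nat.cast_nonneg K) (hd e he)
  by_cases h1 : b e = i <;> by_cases h2 : k ≤ cls e <;> simp [h1, h2, h0, hr.lower e he]

/-- If the schedules `a` and `b` have the same numbers of large items of each class on machine `i`,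
and a large item has class at least `k`, then the large items on that machine cost at most
`1 + 1 / k` times as much in `a` as in `b`. -/
theorem large_load_le (hk : 0 < k) (hK : 0 < K) (hd : ∀ e < m, 0 ≤ d e)
    (hr : Rounds m d G K cls) (hG : 0 ≤ G) {i : ℕ} (hb : load d m b i ≤ B)
    (hab : ∀ s, k ≤ s → s ≤ K → classCount cls m a s i = classCount cls m b s i) :
    k * ∑ e ∈ Finset.range m, (if a e = i ∧ k ≤ cls e then d e else 0) ≤ (k + 1) * B := by
  have h1 := sum_class_mul_le (k := k) hd hr hb
  have h2 : ∑ e ∈ Finset.range m, (if a e = i ∧ k ≤ cls e then cls e else 0) =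
      ∑ e ∈ Finset.range m, (if b e = i ∧ k ≤ cls e then cls e else 0) := by
    rw [sum_class_eq hr.le, sum_class_eq hr.le]
    refine Finset.sum_congr rfl fun s hs => ?_
    split_ifs with h
    · rw [hab s h (by have := Finset.mem_range.1 hs; omega)]
    · rfl
  have h3 : (K : ℝ) * (k * ∑ e ∈ Finset.range m, (if a e = i ∧ k ≤ cls e then d e else 0)) ≤
      (k + 1) *
        (((∑ e ∈ Finset.range m, if a e = i ∧ k ≤ cls e then cls e else 0 : ℕ) : ℝ) * G) := by
    push_cast
    rw [Finset.mul_sum, Finset.mul_sum, Finset.sum_mul, Finset.mul_sum]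
    refine Finset.sum_le_sum fun e he => ?_
    have he := Finset.mem_range.1 he
    split_ifs with h
    · have h4 := mul_le_mul_of_nonneg_left (hr.upper e he) (Nat.cast_nonneg (α := ℝ) k)
      have h5 : (k : ℝ) ≤ cls e := by exact_mod_cast h.2
      have h6 := mul_le_mul_of_nonneg_right h5 hG
      linarith
    · simp
  rw [h2] at h3
  have h4 := h3.trans (mul_le_mul_of_nonneg_left h1 (by positivity))
  have h5 : (0 : ℝ) < K := by exact_mod_cast hK
  exact le_of_mul_le_mul_left (by linarith) h5

/-- A small item costs at most `B / k`. -/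
theorem small_item_le (hk : 0 < k) (hr : Rounds m d G (2 * k ^ 2) cls) (hG : 0 ≤ G)
    (hGB : G ≤ 2 * B) {e : ℕ} (he : e < m) (h : cls e < k) : k * d e ≤ B := by
  have h1 := hr.upper e he
  have h2 : ((cls e : ℝ) + 1) ≤ k := by exact_mod_cast h
  have h3 := mul_le_mul_of_nonneg_right h2 hG
  have hk' : (0 : ℝ) < k := by exact_mod_cast hk
  have h4 := mul_le_mul_of_nonneg_left hGB hk'.le
  push_cast at h1
  have h5 : (2 * k : ℝ) * (k * d e) ≤ (2 * k) * B := by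
    calc (2 * k : ℝ) * (k * d e) = 2 * k ^ 2 * d e := by ring
      _ ≤ (2 * k) * B := by linarith
  exact le_of_mul_le_mul_left h5 (by positivity)

/-- The schedule with the class counts of `b`, improved by a pass over the small items. -/
theorem load_le_of_classCount {a₀ : ℕ → ℕ} (hn : 0 < n) (hk : 0 < k) (hd : ∀ e < m, 0 ≤ d e)
    (hr : Rounds m d G (2 * k ^ 2) cls) (hG : 0 ≤ G) (hGB : G ≤ 2 * B)
    (hb : Valid n m b) (hB : ∀ i < n, load d m b i ≤ B)
    (hab : ∀ s, k ≤ s → s ≤ 2 * k ^ 2 → ∀ i < n, classCount cls m a₀ s i = classCount cls m b s i)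
    (h : PassInv n m d (fun e => cls e < k) a₀ m a) {i : ℕ} (hi : i < n) :
    k * load d m a i ≤ (k + 1) * B := by
  have hk' : (0 : ℝ) < k := by exact_mod_cast hk
  have key : load d m a i ≤ B + B / k := by
    refine h.load_le_add hn hb hB (fun e he hE => ?_) (fun i hi hlarge => ?_) hi
    · rw [le_div_iff₀ hk', mul_comm]
      exact small_item_le hk hr hG hGB he hE
    · have h1 := large_load_le (a := a₀) hk (by positivity) hd hr hG (hB i hi)
        (fun s h1 h2 => hab s h1 h2 i hi)
      have h2 : load d m a i ≤
          ∑ e ∈ Finset.range m, (if a₀ e = i ∧ k ≤ cls e then d e else 0) := by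
        refine Finset.sum_le_sum fun e he => ?_
        have he := Finset.mem_range.1 he
        by_cases hae : a e = i
        · have h3 := hlarge e he hae
          rw [if_pos hae, if_pos]
          exact ⟨by rw [← h.keep e h3, hae], not_lt.1 h3⟩
        · rw [if_neg hae]
          split_ifs
          exacts [hd e he, le_rfl]
      have h3 := (mul_le_mul_of_nonneg_left h2 hk'.le).trans h1
      rw [← mul_le_mul_iff_of_pos_left hk']
      have : (k : ℝ) * (B + B / k) = (k + 1) * B := by field_simp
      linarith
  have := mul_le_mul_of_nonneg_left key hk'.le
  have h4 : (k : ℝ) * (B + B / k) = (k + 1) * B := by field_simp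
  linarith

end

/-! ### Guessing the numbers of large items -/

/-- The number of items of class `s` on a machine with the configuration `q`: the digit number `s`
of `q` in base `K + 1`. -/
def tab (K q s : ℕ) : ℕ := q / (K + 1) ^ s % (K + 1)

/-- The number of configurations. -/
def numConf (K : ℕ) : ℕ := (K + 1) ^ (K + 1)

theorem exists_conf {K : ℕ} (f : ℕ → ℕ) (hf : ∀ s, f s ≤ K) :
    ∃ q < numConf K, ∀ s ≤ K, tab K q s = f s := by
  let g : Fin (K + 1) → Fin (K + 1) := fun s => ⟨f s, Nat.lt_succ_of_le (hf s)⟩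
  refine ⟨finFunctionFinEquiv g, (finFunctionFinEquiv g).2, fun s hs => ?_⟩
  have h := congrFun (finFunctionFinEquiv.symm_apply_apply g) ⟨s, Nat.lt_succ_of_le hs⟩
  exact congrArg Fin.val h

/-- The configuration of machine `i` that the thresholds `x` describe, among those below `Q`, given
by its number of items of class `s`. -/
def guess (K : ℕ) (x : ℕ → ℕ) (s i : ℕ) : ℕ → ℕ
  | 0 => 0
  | q + 1 => if i < x q then guess K x s i q else tab K q s

theorem guess_congr {K s i : ℕ} {x y : ℕ → ℕ} : ∀ {Q : ℕ}, (∀ q < Q, x q = y q) →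
    guess K x s i Q = guess K y s i Q
  | 0, _ => rfl
  | Q + 1, h => by
    rw [guess, guess, h Q (by omega), guess_congr fun q hq => h q (by omega)]

theorem guess_eq {K s i c : ℕ} {x : ℕ → ℕ} : ∀ {Q : ℕ}, (∀ q < Q, x q ≤ i ↔ q ≤ c) → c < Q →
    guess K x s i Q = tab K c s
  | 0, _, h => absurd h (Nat.not_lt_zero _)
  | Q + 1, hx, hc => by
    rw [guess]
    have h := hx Q (by omega)
    split_ifs with hi
    · exact guess_eq (fun q hq => hx q (by omega)) (by omega)
    · have : Q = c := by omega
      rw [this]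

/-- Up to the order of the machines, the class counts of a schedule are described by thresholds,
provided that they are at most `K` for large items. -/
theorem exists_guess {n m k K : ℕ} {d : ℕ → ℝ} {b cls : ℕ → ℕ} {B : ℝ} (hb : Valid n m b)
    (hB : ∀ i < n, load d m b i ≤ B)
    (hK : ∀ s, k ≤ s → ∀ i < n, classCount cls m b s i ≤ K) :
    ∃ (b' x : ℕ → ℕ), Valid n m b' ∧ (∀ i < n, load d m b' i ≤ B) ∧ (∀ q, x q ≤ n) ∧
      ∀ s, k ≤ s → s ≤ K → ∀ i < n, guess K x s i (numConf K) = classCount cls m b' s i := by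
  have h1 : ∀ i : Fin n, ∃ q < numConf K, ∀ s ≤ K,
      tab K q s = if k ≤ s then classCount cls m b s i else 0 := fun i =>
    exists_conf (fun s => if k ≤ s then classCount cls m b s i else 0) fun s => by
      split_ifs with h
      exacts [hK s h i i.2, Nat.zero_le _]
  choose f hf1 hf2 using h1
  set σ := Tuple.sort f with hσ
  have hmono : Monotone (f ∘ σ) := Tuple.monotone_sort f
  let b' : ℕ → ℕ := fun e => if h : b e < n then (σ.symm ⟨b e, h⟩ : ℕ) else 0
  have hb' : ∀ e < m, ∀ i : Fin n, b' e = i ↔ b e = σ i := by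
    intro e he i
    simp only [b', dif_pos (hb e he), Fin.val_inj, Equiv.symm_apply_eq, Fin.ext_iff]
  let x : ℕ → ℕ := fun q => (Finset.univ.filter fun i : Fin n => f (σ i) < q).card
  refine ⟨b', x, fun e he => ?_, fun i hi => ?_, fun q => ?_, fun s hks hsK i hi => ?_⟩
  · simp only [b', dif_pos (hb e he), Fin.is_lt]
  · refine le_of_eq_of_le ?_ (hB (σ ⟨i, hi⟩) (Fin.is_lt _))
    refine Finset.sum_congr rfl fun e he => ?_
    simp only [hb' e (Finset.mem_range.1 he) ⟨i, hi⟩]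
  · exact (Finset.card_le_univ _).trans_eq (Fintype.card_fin n)
  · rw [guess_eq (c := f (σ ⟨i, hi⟩)) _ (hf1 _), hf2 _ s hsK, if_pos hks, classCount, classCount]
    · congr 1
      refine Finset.filter_congr fun e he => ?_
      rw [hb' e (Finset.mem_range.1 he) ⟨i, hi⟩]
    · intro q _
      constructor
      · -- If machine `i` had a configuration below `q`, so would the machines before it.
        intro hxi
        by_contra! hlt
        have : (Finset.Iic (⟨i, hi⟩ : Fin n)).card ≤ x q :=
          Finset.card_le_card fun j hj => by
            simp only [Finset.mem_filter, Finset.mem_univ, true_and, Finset.mem_Iic] at hj ⊢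
            exact (hmono hj).trans_lt hlt
        rw [Fin.card_Iic] at this
        simp only at this
        omega
      · intro hq
        have : x q ≤ (Finset.Iio (⟨i, hi⟩ : Fin n)).card :=
          Finset.card_le_card fun j hj => by
            simp only [Finset.mem_filter, Finset.mem_univ, true_and, Finset.mem_Iio] at hj ⊢
            by_contra! hji
            have := hmono hji
            simp only [Function.comp] at this
            omega
        rw [Fin.card_Iio] at this
        simpa using this

/-- For a schedule of makespan less than `G`, the class counts of large items are at most `K`. -/
theorem classCount_le {n m k K : ℕ} {d : ℕ → ℝ} {b cls : ℕ → ℕ} {B G : ℝ} (hk : 0 < k)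
    (hd : ∀ e < m, 0 ≤ d e) (hr : Rounds m d G K cls) (hBG : B < G) (hB0 : 0 ≤ B)
    (hB : ∀ i < n, load d m b i ≤ B) {s : ℕ} (hs : k ≤ s) {i : ℕ} (hi : i < n) :
    classCount cls m b s i ≤ K := by
  have h1 := sum_class_mul_le (k := k) hd hr (hB i hi)
  have h2 : (∑ e ∈ Finset.range m, if b e = i ∧ k ≤ cls e then cls e else 0) ≤ K := by
    have h3 : (K : ℝ) * B ≤ K * G := mul_le_mul_of_nonneg_left hBG.le (Nat.cast_nonneg K)
    have h4 := le_of_mul_le_mul_right (h1.trans h3) (hB0.trans_lt hBG)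
    exact_mod_cast h4
  refine le_trans ?_ h2
  rw [classCount, Finset.card_filter]
  refine Finset.sum_le_sum fun e _ => ?_
  by_cases h1 : cls e = s <;> by_cases h2 : b e = i <;> simp [h1, h2, hs]
  omega

/-! ### Passes over the items -/

/-! Layout of the memory: register `0` holds the number of agents and `1` the number of items, `2`
and `3` are the counters for agents and items, `4` holds an agent, `5` the first cell of a row of
the cost matrix, `6` the class that bounds a pass, and `8, 9, …` hold the guessed thresholds. The
arrays of natural numbers hold: `0` the best schedule, `1` the current schedule, `2` the classes,
`3` the remaining capacities, `4` the number plus one of an agent for whom the item costs nothing,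
or `0`. The arrays of costs hold: `0` the cost matrix, `1` the common costs, `2` the current loads,
and in their cells `0`: `3` the current makespan, `4` the least makespan, `5` the makespan of the
first schedule. -/

namespace Prog

/-- Find a machine of least load. -/
def argmin : Prog :=
  seq (setReg 4 (.lit 0)) (loop 2 0 0
    (branch (.vlt (.get 2 (.reg 2)) (.get 2 (.reg 4))) (setReg 4 (.reg 2)) skip))

theorem run_argmin (s : State ℝ) (hn : 0 < s.reg 0) :
    (argmin.run s).reg 4 < s.reg 0 ∧
      ∀ i < s.reg 0, s.val 2 ((argmin.run s).reg 4) ≤ s.val 2 i := by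
  have h := run_loop (x := 2) (r := 0) (k := 0)
    (p := branch (.vlt (.get 2 (.reg 2)) (.get 2 (.reg 4))) (setReg 4 (.reg 2)) skip)
    (s := s.putReg 4 0)
    (fun i t => t.reg 4 < s.reg 0 ∧ ∀ i' < i, s.val 2 (t.reg 4) ≤ s.val 2 i')
    (by simp [writesReg]) (by simp [hn]) ?_
  · simpa [argmin, run, NExp.eval] using h
  · rintro i t hi hti hfr ⟨h1, h2⟩
    have hv : t.val 2 = s.val 2 := hfr.val 2 (by simp [writesVal])
    simp only [putReg_reg, add_zero] at hi
    by_cases hlt : s.val 2 i < s.val 2 (t.reg 4)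
    · simp only [run, BExp.eval, VExp.eval, NExp.eval, hti, hv, if_pos hlt]
      simp only [putReg_reg]
      refine ⟨by simpa using hi, fun i' hi' => ?_⟩
      rcases Nat.lt_succ_iff_lt_or_eq.1 hi' with h | rfl
      · simpa using hlt.le.trans (h2 i' h)
      · simp
    · simp only [run, BExp.eval, VExp.eval, NExp.eval, hti, hv, if_neg hlt]
      simp only [putReg_reg]
      refine ⟨by simpa using h1, fun i' hi' => ?_⟩
      rcases Nat.lt_succ_iff_lt_or_eq.1 hi' with h | rfl
      · simpa using h2 i' h
      · simpa using hlt

/-- Compute the loads of the current schedule. -/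
def loads : Prog :=
  seq (loop 2 0 0 (setVal 2 (.reg 2) .zero))
    (loop 3 1 0 (setVal 2 (.get 1 (.reg 3))
      (.add (.get 2 (.get 1 (.reg 3))) (.get 1 (.reg 3)))))

theorem run_loads (s : State ℝ) :
    ∀ i < s.reg 0, (loads.run s).val 2 i = load (s.val 1) (s.reg 1) (s.nat 1) i := by
  have h1 := run_loop (x := 2) (r := 0) (k := 0) (p := setVal 2 (.reg 2) .zero) (s := s)
    (fun i t => ∀ i' < i, t.val 2 i' = 0) (by simp [writesReg]) (by simp) ?_
  swap
  · intro i t hi hti hfr h i' hi'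
    simp only [run, NExp.eval, VExp.eval, hti, putReg_val, putVal_val, if_pos,
      Function.update_apply]
    split_ifs with hii
    exacts [rfl, h i' (by omega)]
  set u := (loop 2 0 0 (setVal 2 (.reg 2) .zero)).run s with hu
  have fr : Frame _ s u := frame_run _ _
  have hu0 : u.reg 0 = s.reg 0 := fr.reg 0 (by simp [writesReg])
  have hu1 : u.reg 1 = s.reg 1 := fr.reg 1 (by simp [writesReg])
  have hun : u.nat 1 = s.nat 1 := fr.nat 1 (by simp [writesNat])
  have huv : u.val 1 = s.val 1 := fr.val 1 (by simp [writesVal])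
  have h2 := run_loop (x := 3) (r := 1) (k := 0) (p := setVal 2 (.get 1 (.reg 3))
      (.add (.get 2 (.get 1 (.reg 3))) (.get 1 (.reg 3)))) (s := u)
    (fun e t => ∀ i < s.reg 0, t.val 2 i = load (s.val 1) e (s.nat 1) i)
    (by simp [writesReg])
    (fun i hi => by simpa [load] using h1 i hi) ?_
  · rw [hu1, add_zero] at h2
    rw [loads, run, ← hu]
    exact h2
  · intro e t he hte hfr h i hi
    have htn : t.nat 1 = s.nat 1 := (hfr.nat 1 (by simp [writesNat])).trans hun
    have htv : t.val 1 = s.val 1 := (hfr.val 1 (by simp [writesVal])).trans huv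
    have h3 := h i hi
    rw [load] at h3 ⊢
    rw [Finset.sum_range_succ, ← h3]
    simp only [run, NExp.eval, VExp.eval, hte, putReg_val, putVal_val, if_pos,
      Function.update_apply, htn, htv]
    by_cases hii : i = s.nat 1 e
    · simp [hii]
    · simp [hii, Ne.symm hii]

/-- Move item number `e` (in register `3`) to a machine of least load if that reduces the makespan
of the two machines involved. -/
def improve : Prog :=
  seq argmin
    (branch (.vlt (.get 2 (.reg 4)) (.sub (.get 2 (.get 1 (.reg 3))) (.get 1 (.reg 3))))
      (seq (setVal 2 (.get 1 (.reg 3)) (.sub (.get 2 (.get 1 (.reg 3))) (.get 1 (.reg 3))))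
        (seq (setVal 2 (.reg 4) (.add (.get 2 (.reg 4)) (.get 1 (.reg 3))))
          (setNat 1 (.reg 3) (.reg 4))))
      skip)

/-- Offer each item whose class is less than register `6` to the least loaded machine. -/
def pass : Prog :=
  loop 3 1 0 (branch (.nlt (.get 2 (.reg 3)) (.reg 6)) improve skip)

theorem run_improve {E : ℕ → Prop} {a₀ : ℕ → ℕ} {e : ℕ} (s : State ℝ) (hn : 0 < s.reg 0)
    (he : s.reg 3 = e) (hem : e < s.reg 1) (hd : 0 ≤ s.val 1 e) (hE : E e)
    (hinv : PassInv (s.reg 0) (s.reg 1) (s.val 1) E a₀ e (s.nat 1))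
    (hL : ∀ i < s.reg 0, s.val 2 i = load (s.val 1) (s.reg 1) (s.nat 1) i) :
    PassInv (s.reg 0) (s.reg 1) (s.val 1) E a₀ (e + 1) ((improve.run s).nat 1) ∧
      ∀ i < s.reg 0, (improve.run s).val 2 i =
        load (s.val 1) (s.reg 1) ((improve.run s).nat 1) i := by
  obtain ⟨hj, hmin⟩ := run_argmin s hn
  have fr : Frame _ s (argmin.run s) := frame_run _ _
  rw [improve, run]
  set u := argmin.run s with hu
  have hu3 : u.reg 3 = e := (fr.reg 3 (by simp [argmin, writesReg])).trans he
  have hun : u.nat 1 = s.nat 1 := fr.nat 1 (by simp [argmin, writesNat])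
  have huv : u.val 1 = s.val 1 := fr.val 1 (by simp [argmin, writesVal])
  have huv2 : u.val 2 = s.val 2 := fr.val 2 (by simp [argmin, writesVal])
  set j := u.reg 4 with hjdef
  have hmin' : ∀ i < s.reg 0, load (s.val 1) (s.reg 1) (s.nat 1) j ≤
      load (s.val 1) (s.reg 1) (s.nat 1) i := fun i hi => by
    rw [← hL j hj, ← hL i hi]; exact hmin i hi
  have hae := hinv.valid e hem
  by_cases hlt : s.val 2 j < s.val 2 (s.nat 1 e) - s.val 1 e
  · have hne : s.nat 1 e ≠ j := by intro h; rw [h] at hlt; linarith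
    simp only [run, BExp.eval, VExp.eval, NExp.eval, hun, huv, huv2, hu3, ← hjdef, if_pos hlt]
    simp only [putNat_nat, putNat_val, putVal_nat, putVal_val, putVal_reg, if_pos, hun, huv, huv2,
      hu3, ← hjdef, Function.update_of_ne hne.symm]
    rw [hL j hj, hL _ hae] at hlt
    refine ⟨hinv.move hem hd hE hj hmin' hlt, fun i hi => ?_⟩
    rw [load_update hem, ← hL i hi]
    rcases eq_or_ne i j with rfl | h1
    · simp [hne]
    · rcases eq_or_ne i (s.nat 1 e) with rfl | h2
      · simp [h1, h1.symm]
      · simp [h1, h1.symm, h2, h2.symm]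
  · simp only [run, BExp.eval, VExp.eval, NExp.eval, hun, huv, huv2, hu3, ← hjdef, if_neg hlt]
    rw [hL j hj, hL _ hae] at hlt
    exact ⟨hinv.stay hE hmin' hlt, hL⟩

theorem run_pass (s : State ℝ) (hn : 0 < s.reg 0) (hd : ∀ e < s.reg 1, 0 ≤ s.val 1 e)
    (ha : Valid (s.reg 0) (s.reg 1) (s.nat 1))
    (hL : ∀ i < s.reg 0, s.val 2 i = load (s.val 1) (s.reg 1) (s.nat 1) i) :
    PassInv (s.reg 0) (s.reg 1) (s.val 1) (fun e => s.nat 2 e < s.reg 6) (s.nat 1) (s.reg 1)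
      ((pass.run s).nat 1) ∧
      ∀ i < s.reg 0, (pass.run s).val 2 i =
        load (s.val 1) (s.reg 1) ((pass.run s).nat 1) i := by
  refine run_loop (x := 3) (r := 1) (k := 0)
    (p := branch (.nlt (.get 2 (.reg 3)) (.reg 6)) improve skip) (s := s)
    (fun e t => PassInv (s.reg 0) (s.reg 1) (s.val 1) (fun e => s.nat 2 e < s.reg 6) (s.nat 1) e
      (t.nat 1) ∧ ∀ i < s.reg 0, t.val 2 i = load (s.val 1) (s.reg 1) (t.nat 1) i)
    (by simp [writesReg, improve, argmin]) ⟨.init ha, hL⟩ ?_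
  rintro e t he hte hfr ⟨h1, h2⟩
  have ht0 : t.reg 0 = s.reg 0 := hfr.reg 0 (by simp [writesReg, improve, argmin])
  have ht1 : t.reg 1 = s.reg 1 := hfr.reg 1 (by simp [writesReg, improve, argmin])
  have ht6 : t.reg 6 = s.reg 6 := hfr.reg 6 (by simp [writesReg, improve, argmin])
  have htn : t.nat 2 = s.nat 2 := hfr.nat 2 (by simp [writesNat, improve, argmin])
  have htv : t.val 1 = s.val 1 := hfr.val 1 (by simp [writesVal, improve, argmin])
  rw [add_zero] at he
  simp only [run, BExp.eval, NExp.eval, htn, hte, ht6, putReg_nat, putReg_val]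
  split_ifs with hE
  · have := run_improve (E := fun e => s.nat 2 e < s.reg 6) (a₀ := s.nat 1) (e := e) t
    simp only [ht0, ht1, htv] at this
    exact this hn hte he (hd e he) hE h1 h2
  · exact ⟨h1.skip hE, h2⟩

/-- Compute the makespan of the current schedule. -/
def makespan : Prog :=
  seq (setVal 3 (.lit 0) (.get 2 (.lit 0))) (loop 2 0 0
    (branch (.vlt (.get 3 (.lit 0)) (.get 2 (.reg 2))) (setVal 3 (.lit 0) (.get 2 (.reg 2))) skip))

theorem run_makespan (s : State ℝ) (hn : 0 < s.reg 0) :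
    (∃ i < s.reg 0, (makespan.run s).val 3 0 = s.val 2 i) ∧
      ∀ i < s.reg 0, s.val 2 i ≤ (makespan.run s).val 3 0 := by
  have h := run_loop (x := 2) (r := 0) (k := 0)
    (p := branch (.vlt (.get 3 (.lit 0)) (.get 2 (.reg 2)))
      (setVal 3 (.lit 0) (.get 2 (.reg 2))) skip)
    (s := s.putVal 3 0 (s.val 2 0))
    (fun i t => (∃ i < s.reg 0, t.val 3 0 = s.val 2 i) ∧ ∀ i' < i, s.val 2 i' ≤ t.val 3 0)
    (by simp [writesReg]) ⟨⟨0, hn, by simp⟩, by simp⟩ ?_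
  · simpa [makespan, run, NExp.eval, VExp.eval] using h
  · rintro i t hi hti hfr ⟨h1, h2⟩
    have hv : t.val 2 = s.val 2 := by
      rw [hfr.val 2 (by simp [writesVal])]
      simp
    simp only [putVal_reg, add_zero] at hi
    simp only [run, BExp.eval, VExp.eval, NExp.eval, hti, hv]
    split_ifs with hlt
    · simp only [putReg_val, putVal_val, if_pos, Function.update_self]
      refine ⟨⟨i, hi, rfl⟩, fun i' hi' => ?_⟩
      rcases Nat.lt_succ_iff_lt_or_eq.1 hi' with h | rfl
      · exact (h2 i' h).trans hlt.le
      · exact le_rfl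
    · refine ⟨h1, fun i' hi' => ?_⟩
      rcases Nat.lt_succ_iff_lt_or_eq.1 hi' with h | rfl
      · exact h2 i' h
      · exact not_lt.1 hlt

/-- Store the current schedule as the best one. -/
def copy : Prog := loop 3 1 0 (setNat 0 (.reg 3) (.get 1 (.reg 3)))

theorem run_copy (s : State ℝ) : ∀ e < s.reg 1, (copy.run s).nat 0 e = s.nat 1 e := by
  refine run_loop (x := 3) (r := 1) (k := 0) (p := setNat 0 (.reg 3) (.get 1 (.reg 3))) (s := s)
    (fun e t => ∀ e' < e, t.nat 0 e' = s.nat 1 e') (by simp [writesReg]) (by simp) ?_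
  intro e t he hte hfr h e' he'
  have htn : t.nat 1 = s.nat 1 := hfr.nat 1 (by simp [writesNat])
  simp only [run, NExp.eval, hte, htn, putReg_nat, putNat_nat, if_pos, Function.update_apply]
  split_ifs with hee
  · rw [hee]
  · exact h e' (by omega)

end Prog

/-- A fair schedule is stored as the best one, and its makespan is at most the stored number. -/
structure Good (s : State ℝ) : Prop where
  valid : Valid (s.reg 0) (s.reg 1) (s.nat 0)
  fair : Fair (s.reg 0) (s.reg 1) (s.val 1) (s.nat 0)
  load_le : ∀ i < s.reg 0, load (s.val 1) (s.reg 1) (s.nat 0) i ≤ s.val 4 0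

theorem Valid.congr {n m : ℕ} {a b : ℕ → ℕ} (h : Valid n m a) (hab : ∀ e < m, b e = a e) :
    Valid n m b := fun e he => by
  rw [hab e he]; exact h e he

theorem Fair.congr {n m : ℕ} {d : ℕ → ℝ} {a b : ℕ → ℕ} (h : Fair n m d a)
    (hab : ∀ e < m, b e = a e) : Fair n m d b := fun i hi j hj => by
  have hl : ∀ i, load d m b i = load d m a i := load_congr fun e he => ⟨hab e he, rfl⟩
  rw [hl, hl]
  refine (h i hi j hj).imp_right ?_
  rintro ⟨w, hw, haw, h⟩
  exact ⟨w, hw, (hab w hw).trans haw, h⟩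

namespace Prog

/-- Keep the better one of the current schedule and the best one so far. -/
def keep : Prog :=
  seq makespan (branch (.vlt (.get 3 (.lit 0)) (.get 4 (.lit 0)))
    (seq copy (setVal 4 (.lit 0) (.get 3 (.lit 0)))) skip)

theorem run_keep (s : State ℝ) (hn : 0 < s.reg 0)
    (ha : Valid (s.reg 0) (s.reg 1) (s.nat 1)) (hf : Fair (s.reg 0) (s.reg 1) (s.val 1) (s.nat 1))
    (hL : ∀ i < s.reg 0, s.val 2 i = load (s.val 1) (s.reg 1) (s.nat 1) i) :
    (Good s → Good (keep.run s)) ∧ (keep.run s).val 4 0 ≤ s.val 4 0 ∧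
      ∃ i < s.reg 0, (keep.run s).val 4 0 ≤ load (s.val 1) (s.reg 1) (s.nat 1) i := by
  obtain ⟨⟨i₀, hi₀, hM⟩, hmax⟩ := run_makespan s hn
  have fr : Frame _ s (makespan.run s) := frame_run _ _
  have fr' : Frame _ s (keep.run s) := frame_run _ _
  have hk0 : (keep.run s).reg 0 = s.reg 0 :=
    fr'.reg 0 (by simp [keep, makespan, copy, writesReg])
  have hk1 : (keep.run s).reg 1 = s.reg 1 :=
    fr'.reg 1 (by simp [keep, makespan, copy, writesReg])
  have hkv : (keep.run s).val 1 = s.val 1 :=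
    fr'.val 1 (by simp [keep, makespan, copy, writesVal])
  rw [keep, run] at *
  set u := makespan.run s with hu
  have hu1 : u.reg 1 = s.reg 1 := fr.reg 1 (by simp [makespan, writesReg])
  have hun : u.nat 1 = s.nat 1 := fr.nat 1 (by simp [makespan, writesNat])
  have hun0 : u.nat 0 = s.nat 0 := fr.nat 0 (by simp [makespan, writesNat])
  have huv4 : u.val 4 = s.val 4 := fr.val 4 (by simp [makespan, writesVal])
  by_cases hlt : u.val 3 0 < s.val 4 0
  · have hcopy := run_copy u
    have fr3 : Frame _ u (copy.run u) := frame_run _ _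
    have h3 : (copy.run u).val 3 = u.val 3 := fr3.val 3 (by simp [copy, writesVal])
    rw [hu1, hun] at hcopy
    simp only [run, BExp.eval, VExp.eval, NExp.eval, huv4, if_pos hlt] at hk0 hk1 hkv ⊢
    have hbest : ((copy.run u).putVal 4 0 ((copy.run u).val 3 0)).val 4 0 = u.val 3 0 := by
      simp [h3]
    rw [hbest]
    refine ⟨fun _ => ⟨?_, ?_, ?_⟩, hlt.le, i₀, hi₀, ?_⟩
    · rw [hk0, hk1]; exact ha.congr hcopy
    · rw [hk0, hk1, hkv]; exact hf.congr hcopy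
    · rw [hk0, hk1, hkv, hbest]
      intro i hi
      rw [putVal_nat, load_congr (b := s.nat 1) (d' := s.val 1) (fun e he => ⟨hcopy e he, rfl⟩),
        ← hL i hi]
      exact hmax i hi
    · rw [hM, hL i₀ hi₀]
  · simp only [run, BExp.eval, VExp.eval, NExp.eval, huv4, if_neg hlt] at hk0 hk1 hkv ⊢
    refine ⟨fun h => ⟨?_, ?_, ?_⟩, le_rfl, i₀, hi₀, ?_⟩
    · rw [hk0, hk1, hun0]; exact h.valid
    · rw [hk0, hk1, hkv, hun0]; exact h.fair
    · rw [hk0, hk1, hkv, hun0, huv4]; exact h.load_le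
    · rw [← hL i₀ hi₀, ← hM]; exact not_lt.1 hlt

end Prog

/-! ### Distributing the large items -/

section
variable {n m : ℕ} {cls a b : ℕ → ℕ}

theorem classCount_succ (cls : ℕ → ℕ) (m : ℕ) (a : ℕ → ℕ) (s i : ℕ) :
    classCount cls (m + 1) a s i =
      classCount cls m a s i + if cls m = s ∧ a m = i then 1 else 0 := by
  simp only [classCount, Finset.card_filter, Finset.sum_range_succ]

theorem classCount_congr {s : ℕ} (h : ∀ e < m, cls e = s → a e = b e) (i : ℕ) :
    classCount cls m a s i = classCount cls m b s i := by
  unfold classCount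
  congr 1
  refine Finset.filter_congr fun e he => ?_
  by_cases hs : cls e = s
  · rw [h e (Finset.mem_range.1 he) hs]
  · simp [hs]

/-- The number of items of class `s`. -/
def classTotal (cls : ℕ → ℕ) (m s : ℕ) : ℕ := ((Finset.range m).filter fun e => cls e = s).card

theorem sum_classCount (ha : Valid n m a) (s : ℕ) :
    ∑ i ∈ Finset.range n, classCount cls m a s i = classTotal cls m s := by
  rw [classTotal, Finset.card_eq_sum_card_fiberwise (f := a) (t := Finset.range n)]
  · refine Finset.sum_congr rfl fun i _ => ?_
    rw [classCount, Finset.filter_filter]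
  · intro e he
    simp only [Finset.coe_filter, Finset.mem_range, Set.mem_ofPred_eq] at he
    simpa using ha e he.1

theorem classTotal_lt {e s : ℕ} (he : e < m) (hs : cls e = s) :
    classTotal cls e s < classTotal cls m s := by
  refine Finset.card_lt_card ⟨?_, fun h => ?_⟩
  · exact Finset.filter_subset_filter _ (Finset.range_subset_range.2 he.le)
  · have := h (Finset.mem_filter.2 ⟨Finset.mem_range.2 he, hs⟩)
    simp at this

end

namespace Prog

/-- Write the number of items of class `c` in the configuration of machine `i` (in register `2`),
as described by the thresholds, into its remaining capacity. -/
def setCap (K c : ℕ) : ℕ → Prog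
  | 0 => setNat 3 (.reg 2) (.lit 0)
  | q + 1 => seq (setCap K c q)
      (branch (.nlt (.reg 2) (.reg (8 + q))) skip (setNat 3 (.reg 2) (.lit (tab K q c))))

theorem run_setCap (K c Q : ℕ) (s : State ℝ) :
    (setCap K c Q).run s =
      s.putNat 3 (s.reg 2) (guess K (fun q => s.reg (8 + q)) c (s.reg 2) Q) := by
  induction Q with
  | zero => rfl
  | succ Q ih =>
    rw [setCap, run, ih, guess, run]
    by_cases h : s.reg 2 < s.reg (8 + Q)
    · rw [if_pos h, if_pos (by simpa [BExp.eval, NExp.eval] using h)]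
      rfl
    · rw [if_neg h, if_neg (by simpa [BExp.eval, NExp.eval] using h)]
      ext x y
      · rfl
      · simp only [run, NExp.eval, putNat_nat, putNat_reg]
        split_ifs <;> simp
      · rfl

@[simp] theorem writesReg_setCap (K c Q y : ℕ) : ¬ (setCap K c Q).writesReg y := by
  induction Q <;> simp_all [setCap, writesReg]

@[simp] theorem writesNat_setCap (K c Q y : ℕ) : (setCap K c Q).writesNat y ↔ y = 3 := by
  induction Q <;> simp_all [setCap, writesNat]

@[simp] theorem writesVal_setCap (K c Q y : ℕ) : ¬ (setCap K c Q).writesVal y := by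
  induction Q <;> simp_all [setCap, writesVal]

@[simp] theorem wf_setCap (K c Q : ℕ) : (setCap K c Q).WF := by
  induction Q <;> simp_all [setCap, WF]

/-- Compute the capacities of all machines for items of class `c`. -/
def setCaps (K c : ℕ) : Prog := loop 2 0 0 (setCap K c (numConf K))

theorem run_setCaps (K c : ℕ) (s : State ℝ) : ∀ i < s.reg 0,
    ((setCaps K c).run s).nat 3 i = guess K (fun q => s.reg (8 + q)) c i (numConf K) := by
  refine run_loop (x := 2) (r := 0) (k := 0) (p := setCap K c (numConf K)) (s := s)
    (fun i t => ∀ i' < i, t.nat 3 i' = guess K (fun q => s.reg (8 + q)) c i' (numConf K))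
    (by simp) (by simp) ?_
  intro i t hi hti hfr h i' hi'
  have hreg : (fun q => t.reg (8 + q)) = fun q => s.reg (8 + q) := by
    funext q
    exact hfr.reg _ (by simp [writesReg]; omega)
  rw [run_setCap, hreg, hti]
  simp only [putReg_nat, putNat_nat, if_pos]
  rcases eq_or_ne i' i with rfl | hii
  · rw [Function.update_self]
  · rw [Function.update_of_ne hii]
    exact h i' (by omega)

/-- Find a machine with some capacity left, if there is one. -/
def findCap : Prog :=
  seq (setReg 4 (.lit 0)) (loop 2 0 0
    (branch (.nlt (.lit 0) (.get 3 (.reg 2))) (setReg 4 (.reg 2)) skip))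

theorem run_findCap (s : State ℝ) (hn : 0 < s.reg 0) :
    (findCap.run s).reg 4 < s.reg 0 ∧
      ((∃ i < s.reg 0, 0 < s.nat 3 i) → 0 < s.nat 3 ((findCap.run s).reg 4)) := by
  have h := run_loop (x := 2) (r := 0) (k := 0)
    (p := branch (.nlt (.lit 0) (.get 3 (.reg 2))) (setReg 4 (.reg 2)) skip)
    (s := s.putReg 4 0)
    (fun i t => t.reg 4 < s.reg 0 ∧ ((∃ i' < i, 0 < s.nat 3 i') → 0 < s.nat 3 (t.reg 4)))
    (by simp [writesReg]) (by simp [hn]) ?_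
  · simpa [findCap, run, NExp.eval] using h
  · rintro i t hi hti hfr ⟨h1, h2⟩
    have hv : t.nat 3 = s.nat 3 := hfr.nat 3 (by simp [writesNat])
    simp only [putReg_reg, add_zero] at hi
    simp only [run, BExp.eval, NExp.eval, hti, hv]
    split_ifs with hlt
    · simp only [putReg_reg]
      exact ⟨by simpa using hi, fun _ => by simpa using hlt⟩
    · simp only [putReg_reg]
      refine ⟨by simpa using h1, ?_⟩
      rintro ⟨i', hi', hpos⟩
      rcases Nat.lt_succ_iff_lt_or_eq.1 hi' with h | rfl
      · simpa using h2 ⟨i', h, hpos⟩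
      · exact absurd hpos hlt

/-- Put item number `e` (in register `3`) on a machine with some capacity left. -/
def placeItem : Prog :=
  seq findCap (seq (setNat 1 (.reg 3) (.reg 4))
    (setNat 3 (.reg 4) (.sub (.get 3 (.reg 4)) (.lit 1))))

/-- Distribute the items of class `c` as the capacities say. -/
def placeClass (K c : ℕ) : Prog :=
  seq (setCaps K c) (loop 3 1 0 (branch
    (.conj (.neg (.nlt (.get 2 (.reg 3)) (.lit c))) (.neg (.nlt (.lit c) (.get 2 (.reg 3)))))
    placeItem skip))

theorem run_placeClass (K c : ℕ) (s : State ℝ) (hn : 0 < s.reg 0)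
    (ha : Valid (s.reg 0) (s.reg 1) (s.nat 1)) :
    Valid (s.reg 0) (s.reg 1) (((placeClass K c).run s).nat 1) ∧
    (∀ e, s.nat 2 e ≠ c → ((placeClass K c).run s).nat 1 e = s.nat 1 e) ∧
    (∑ i ∈ Finset.range (s.reg 0), guess K (fun q => s.reg (8 + q)) c i (numConf K) =
      classTotal (s.nat 2) (s.reg 1) c → ∀ i < s.reg 0,
      classCount (s.nat 2) (s.reg 1) (((placeClass K c).run s).nat 1) c i =
        guess K (fun q => s.reg (8 + q)) c i (numConf K)) := by
  have hcap := run_setCaps K c s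
  generalize hg : (fun i => guess K (fun q => s.reg (8 + q)) c i (numConf K)) = cap at *
  have hg' : ∀ i, guess K (fun q => s.reg (8 + q)) c i (numConf K) = cap i := fun i =>
    congrFun hg i
  simp only [hg'] at hcap ⊢
  have fr : Frame _ s ((setCaps K c).run s) := frame_run _ _
  rw [placeClass, run]
  set u := (setCaps K c).run s with hu
  have hu0 : u.reg 0 = s.reg 0 := fr.reg 0 (by simp [setCaps, writesReg])
  have hu1 : u.reg 1 = s.reg 1 := fr.reg 1 (by simp [setCaps, writesReg])
  have hun : u.nat 1 = s.nat 1 := fr.nat 1 (by simp [setCaps, writesNat])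
  have hun2 : u.nat 2 = s.nat 2 := fr.nat 2 (by simp [setCaps, writesNat])
  have h := run_loop (x := 3) (r := 1) (k := 0) (p := branch
    (.conj (.neg (.nlt (.get 2 (.reg 3)) (.lit c))) (.neg (.nlt (.lit c) (.get 2 (.reg 3)))))
    placeItem skip) (s := u)
    (fun e t => Valid (s.reg 0) (s.reg 1) (t.nat 1) ∧
      (∀ e, s.nat 2 e ≠ c → t.nat 1 e = s.nat 1 e) ∧
      (∑ i ∈ Finset.range (s.reg 0), cap i = classTotal (s.nat 2) (s.reg 1) c →
        ∀ i < s.reg 0, classCount (s.nat 2) e (t.nat 1) c i + t.nat 3 i = cap i))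
    (by simp [writesReg, placeItem, findCap]) ?_ ?_
  · rw [hu1, add_zero] at h
    obtain ⟨h1, h2, h3⟩ := h
    refine ⟨h1, h2, fun hsum i hi => ?_⟩
    -- The counts add up to the sum of all capacities, so nothing is left.
    have h4 := sum_classCount (cls := s.nat 2) h1 c
    rw [← hsum, ← Finset.sum_congr rfl fun i hi => h3 hsum i (Finset.mem_range.1 hi),
      Finset.sum_add_distrib] at h4
    have h5 : ∑ i ∈ Finset.range (s.reg 0), (((loop 3 1 0 (branch
        (.conj (.neg (.nlt (.get 2 (.reg 3)) (.lit c))) (.neg (.nlt (.lit c) (.get 2 (.reg 3)))))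
        placeItem skip)).run u).nat 3) i = 0 := by omega
    have h6 := h3 hsum i hi
    rw [Finset.sum_eq_zero_iff.1 h5 i (Finset.mem_range.2 hi)] at h6
    exact h6
  · simp only [putReg_nat, hun]
    exact ⟨ha, by simp, fun _ i hi => by simpa [classCount] using hcap i hi⟩
  · rintro e t he hte hfr ⟨h1, h2, h3⟩
    rw [hu1, add_zero] at he
    have ht0 : t.reg 0 = s.reg 0 :=
      (hfr.reg 0 (by simp [writesReg, placeItem, findCap])).trans hu0
    have ht2 : t.nat 2 = s.nat 2 :=
      (hfr.nat 2 (by simp [writesNat, placeItem, findCap])).trans hun2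
    rw [run]
    split_ifs with hc
    · have hce : s.nat 2 e = c := by
        simp only [BExp.eval, NExp.eval, hte, ht2] at hc
        omega
      obtain ⟨hj, hpos⟩ := run_findCap t (by omega)
      have fr' : Frame _ t (findCap.run t) := frame_run _ _
      rw [placeItem, run]
      set v := findCap.run t with hv
      have hv3 : v.reg 3 = e := (fr'.reg 3 (by simp [findCap, writesReg])).trans hte
      have hvn : v.nat 1 = t.nat 1 := fr'.nat 1 (by simp [findCap, writesNat])
      have hvn3 : v.nat 3 = t.nat 3 := fr'.nat 3 (by simp [findCap, writesNat])
      set j := v.reg 4 with hjdef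
      simp only [run, NExp.eval, putNat_nat, putNat_reg, putReg_nat, ← hjdef, hv3, hvn, hvn3]
      simp only [if_pos, show (1 : ℕ) ≠ 3 by norm_num, show (3 : ℕ) ≠ 1 by norm_num, if_false]
      rw [ht0] at hj hpos
      refine ⟨fun e' he' => ?_, fun e' he' => ?_, fun hsum i hi => ?_⟩
      · rw [Function.update_apply]
        split_ifs
        exacts [hj, h1 e' he']
      · rw [Function.update_of_ne (by rintro rfl; exact he' hce)]
        exact h2 e' he'
      · have hex : ∃ i < s.reg 0, 0 < t.nat 3 i := by
          by_contra! hno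
          have h4 := sum_classCount (cls := s.nat 2) (a := t.nat 1) (m := e)
            (fun e' he' => h1 e' (he'.trans he)) c
          have h5 := classTotal_lt he hce
          rw [← hsum, ← h4, ← Finset.sum_congr rfl fun i hi => h3 hsum i (Finset.mem_range.1 hi),
            Finset.sum_add_distrib, Finset.sum_eq_zero (f := t.nat 3) fun i hi =>
              Nat.le_zero.1 (hno i (Finset.mem_range.1 hi))] at h5
          omega
        have hposj := hpos hex
        have h4 := h3 hsum i hi
        rw [classCount_succ, Function.update_self,
          classCount_congr (b := t.nat 1) (fun e' he' _ => Function.update_of_ne he'.ne _ _)]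
        rcases eq_or_ne i j with rfl | hij
        · simp only [hce, Function.update_self]
          simp
          omega
        · simp only [Function.update_of_ne hij, hij.symm]
          simpa using h4
    · have hce : s.nat 2 e ≠ c := by
        simp only [BExp.eval, NExp.eval, hte, ht2] at hc
        omega
      refine ⟨h1, h2, fun hsum i hi => ?_⟩
      rw [classCount_succ]
      simpa [hce, run] using h3 hsum i hi

/-- Distribute the items of the classes below `J`. -/
def placeAll (K : ℕ) : ℕ → Prog
  | 0 => skip
  | c + 1 => seq (placeAll K c) (placeClass K c)

theorem writesReg_placeClass {K c y : ℕ} (h : (placeClass K c).writesReg y) :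
    y = 2 ∨ y = 3 ∨ y = 4 := by
  simp [placeClass, setCaps, placeItem, findCap, writesReg] at h
  omega

theorem writesReg_placeAll {K J y : ℕ} (h : (placeAll K J).writesReg y) :
    y = 2 ∨ y = 3 ∨ y = 4 := by
  induction J with
  | zero => exact h.elim
  | succ J ih => exact h.elim ih writesReg_placeClass

theorem writesNat_placeAll {K J y : ℕ} (h : (placeAll K J).writesNat y) : y = 1 ∨ y = 3 := by
  induction J with
  | zero => exact h.elim
  | succ J ih =>
    refine h.elim ih fun h => ?_
    simp [placeClass, setCaps, placeItem, findCap, writesNat] at h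
    omega

@[simp] theorem writesVal_placeAll (K J y : ℕ) : ¬ (placeAll K J).writesVal y := by
  induction J <;> simp_all [placeAll, placeClass, setCaps, placeItem, findCap, writesVal]

@[simp] theorem wf_placeAll (K J : ℕ) : (placeAll K J).WF := by
  induction J <;> simp_all [placeAll, placeClass, setCaps, placeItem, findCap, WF, writesReg]

theorem run_placeAll (K J : ℕ) (s : State ℝ) (hn : 0 < s.reg 0)
    (ha : Valid (s.reg 0) (s.reg 1) (s.nat 1)) :
    Valid (s.reg 0) (s.reg 1) (((placeAll K J).run s).nat 1) ∧
    ∀ c < J, ∑ i ∈ Finset.range (s.reg 0), guess K (fun q => s.reg (8 + q)) c i (numConf K) =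
      classTotal (s.nat 2) (s.reg 1) c → ∀ i < s.reg 0,
      classCount (s.nat 2) (s.reg 1) (((placeAll K J).run s).nat 1) c i =
        guess K (fun q => s.reg (8 + q)) c i (numConf K) := by
  induction J with
  | zero => exact ⟨ha, fun c hc => absurd hc (Nat.not_lt_zero _)⟩
  | succ J ih =>
    obtain ⟨h1, h2⟩ := ih
    have fr : Frame _ s ((placeAll K J).run s) := frame_run _ _
    rw [placeAll, run]
    set u := (placeAll K J).run s with hu
    have hureg : ∀ y, ¬ (y = 2 ∨ y = 3 ∨ y = 4) → u.reg y = s.reg y := fun y hy =>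
      fr.reg y fun h => hy (writesReg_placeAll h)
    have hu0 := hureg 0 (by omega)
    have hu1 := hureg 1 (by omega)
    have hu8 : (fun q => u.reg (8 + q)) = fun q => s.reg (8 + q) :=
      funext fun q => hureg _ (by omega)
    have hun2 : u.nat 2 = s.nat 2 := fr.nat 2 fun h => by
      have := writesNat_placeAll h; omega
    have h := run_placeClass K J u (by omega)
    rw [hu0, hu1, hu8, hun2] at h
    obtain ⟨h3, h4, h5⟩ := h h1
    refine ⟨h3, fun c hc hsum i hi => ?_⟩
    rcases Nat.lt_succ_iff_lt_or_eq.1 hc with hc | rfl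
    · rw [classCount_congr (b := u.nat 1) fun e _ he => h4 e (by omega)]
      exact h2 c hc hsum i hi
    · exact h5 hsum i hi

end Prog

/-! ### The search for the best thresholds -/

theorem Good.congr {s t : State ℝ} (h : Good s) (h0 : t.reg 0 = s.reg 0) (h1 : t.reg 1 = s.reg 1)
    (hn : t.nat 0 = s.nat 0) (hv : t.val 1 = s.val 1) (hv4 : t.val 4 = s.val 4) : Good t :=
  ⟨by rw [h0, h1, hn]; exact h.valid, by rw [h0, h1, hn, hv]; exact h.fair,
    by rw [h0, h1, hn, hv, hv4]; exact h.load_le⟩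

namespace Prog

/-- Improve the current schedule by a pass over the items of the classes below `r`, then by one over
all items, and keep it if it is the best one so far. -/
def polish (r K : ℕ) : Prog :=
  seq loads (seq (setReg 6 (.lit r)) (seq pass (seq (setReg 6 (.lit (K + 1))) (seq pass keep))))

theorem run_polish {r K : ℕ} (s : State ℝ) (hn : 0 < s.reg 0) (hd : ∀ e < s.reg 1, 0 ≤ s.val 1 e)
    (ha : Valid (s.reg 0) (s.reg 1) (s.nat 1)) (hcls : ∀ e < s.reg 1, s.nat 2 e ≤ K) :
    (Good s → Good ((polish r K).run s)) ∧ ((polish r K).run s).val 4 0 ≤ s.val 4 0 ∧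
      ∃ a, PassInv (s.reg 0) (s.reg 1) (s.val 1) (fun e => s.nat 2 e < r) (s.nat 1) (s.reg 1) a ∧
        ∀ M, (∀ i < s.reg 0, load (s.val 1) (s.reg 1) a i ≤ M) →
          ((polish r K).run s).val 4 0 ≤ M := by
  have h1 := run_loads s
  have fr1 : Frame _ s (loads.run s) := frame_run _ _
  simp only [polish, run, NExp.eval]
  set s1 := loads.run s
  have r0 : s1.reg 0 = s.reg 0 := fr1.reg 0 (by simp [loads, writesReg])
  have r1 : s1.reg 1 = s.reg 1 := fr1.reg 1 (by simp [loads, writesReg])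
  have n0 : s1.nat 0 = s.nat 0 := fr1.nat 0 (by simp [loads, writesNat])
  have n1 : s1.nat 1 = s.nat 1 := fr1.nat 1 (by simp [loads, writesNat])
  have n2 : s1.nat 2 = s.nat 2 := fr1.nat 2 (by simp [loads, writesNat])
  have v1 : s1.val 1 = s.val 1 := fr1.val 1 (by simp [loads, writesVal])
  have v4 : s1.val 4 = s.val 4 := fr1.val 4 (by simp [loads, writesVal])
  have h2 := run_pass (s1.putReg 6 r)
  have fr2 : Frame _ (s1.putReg 6 r) (pass.run (s1.putReg 6 r)) := frame_run _ _
  set s2 := pass.run (s1.putReg 6 r)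
  have r0' := fr2.reg 0 (by simp [pass, improve, argmin, writesReg])
  have r1' := fr2.reg 1 (by simp [pass, improve, argmin, writesReg])
  have n0' := fr2.nat 0 (by simp [pass, improve, argmin, writesNat])
  have n2' := fr2.nat 2 (by simp [pass, improve, argmin, writesNat])
  have v1' := fr2.val 1 (by simp [pass, improve, argmin, writesVal])
  have v4' := fr2.val 4 (by simp [pass, improve, argmin, writesVal])
  simp only [putReg_nat, putReg_val, putReg_reg, r0, r1, n0, n1, n2, v1, v4, if_true,
    show (0 : ℕ) ≠ 6 by norm_num, show (1 : ℕ) ≠ 6 by norm_num, if_false]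
    at h2 r0' r1' n0' n2' v1' v4'
  obtain ⟨hinv, hL⟩ := h2 hn hd ha h1
  have h3 := run_pass (s2.putReg 6 (K + 1))
  have fr3 : Frame _ (s2.putReg 6 (K + 1)) (pass.run (s2.putReg 6 (K + 1))) := frame_run _ _
  set s3 := pass.run (s2.putReg 6 (K + 1))
  have r0'' := fr3.reg 0 (by simp [pass, improve, argmin, writesReg])
  have r1'' := fr3.reg 1 (by simp [pass, improve, argmin, writesReg])
  have n0'' := fr3.nat 0 (by simp [pass, improve, argmin, writesNat])
  have v1'' := fr3.val 1 (by simp [pass, improve, argmin, writesVal])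
  have v4'' := fr3.val 4 (by simp [pass, improve, argmin, writesVal])
  simp only [putReg_nat, putReg_val, putReg_reg, r0', r1', n0', n2', v1', v4', if_true,
    show (0 : ℕ) ≠ 6 by norm_num, show (1 : ℕ) ≠ 6 by norm_num, if_false]
    at h3 r0'' r1'' n0'' v1'' v4''
  obtain ⟨hinv', hL'⟩ := h3 hn hd hinv.valid hL
  have hfair := hinv'.fair hd fun e he => Nat.lt_succ_of_le (hcls e he)
  have h4 := run_keep s3
  rw [r0'', r1'', v1'', v4''] at h4
  obtain ⟨hgood, hle, i, hi, hM⟩ := h4 hn hinv'.valid hfair hL'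
  exact ⟨fun hg => hgood (hg.congr r0'' r1'' n0'' v1'' v4''), hle, s2.nat 1, hinv,
    fun M hM' => hM.trans (hinv'.load_le M hM' i hi)⟩

/-- Let the current schedule send all items to machine `0`. -/
def clear : Prog := loop 3 1 0 (setNat 1 (.reg 3) (.lit 0))

theorem run_clear (s : State ℝ) : ∀ e < s.reg 1, (clear.run s).nat 1 e = 0 := by
  refine run_loop (x := 3) (r := 1) (k := 0) (p := setNat 1 (.reg 3) (.lit 0)) (s := s)
    (fun e t => ∀ e' < e, t.nat 1 e' = 0) (by simp [writesReg]) (by simp) ?_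
  intro e t he hte hfr h e' he'
  simp only [run, NExp.eval, hte, putReg_nat, putNat_nat, if_pos]
  rcases eq_or_ne e' e with rfl | hee
  · rw [Function.update_self]
  · rw [Function.update_of_ne hee]
    exact h e' (by omega)

/-- Try the schedule that belongs to the guessed thresholds. -/
def attempt (k K : ℕ) : Prog := seq clear (seq (placeAll K (K + 1)) (polish k K))

theorem writesReg_attempt {k K y : ℕ} (h : (attempt k K).writesReg y) :
    y = 2 ∨ y = 3 ∨ y = 4 ∨ y = 6 := by
  rcases h with h | h | h
  · simp [clear, writesReg] at h; omega
  · have := writesReg_placeAll h; omega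
  · simp [polish, loads, pass, improve, argmin, keep, makespan, copy, writesReg] at h; omega

theorem writesNat_attempt {k K y : ℕ} (h : (attempt k K).writesNat y) :
    y = 0 ∨ y = 1 ∨ y = 3 := by
  rcases h with h | h | h
  · simp [clear, writesNat] at h; omega
  · have := writesNat_placeAll h; omega
  · simp [polish, loads, pass, improve, argmin, keep, makespan, copy, writesNat] at h; omega

theorem writesVal_attempt {k K y : ℕ} (h : (attempt k K).writesVal y) :
    y = 2 ∨ y = 3 ∨ y = 4 := by
  rcases h with h | h | h
  · simp [clear, writesVal] at h
  · exact absurd h (writesVal_placeAll _ _ _)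
  · simp [polish, loads, pass, improve, argmin, keep, makespan, copy, writesVal] at h; omega

theorem wf_attempt (k K : ℕ) : (attempt k K).WF := by
  simp [attempt, clear, polish, loads, pass, improve, argmin, keep, makespan, copy, WF, writesReg]

/-- An attempt keeps the best schedule good and does not raise its makespan. If the thresholds
describe the class counts of a schedule `b` of makespan at most `B`, the best makespan afterwards is
at most `(1 + 1 / k) * B`. -/
theorem run_attempt {k : ℕ} (s : State ℝ) (hk : 0 < k) (hn : 0 < s.reg 0)
    (hd : ∀ e < s.reg 1, 0 ≤ s.val 1 e) (hcls : ∀ e < s.reg 1, s.nat 2 e ≤ 2 * k ^ 2) :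
    (Good s → Good ((attempt k (2 * k ^ 2)).run s)) ∧
    ((attempt k (2 * k ^ 2)).run s).val 4 0 ≤ s.val 4 0 ∧
    ∀ (b : ℕ → ℕ) (B G : ℝ), Rounds (s.reg 1) (s.val 1) G (2 * k ^ 2) (s.nat 2) → 0 ≤ G →
      G ≤ 2 * B → Valid (s.reg 0) (s.reg 1) b →
      (∀ i < s.reg 0, load (s.val 1) (s.reg 1) b i ≤ B) →
      (∀ c, k ≤ c → c ≤ 2 * k ^ 2 → ∀ i < s.reg 0,
        guess (2 * k ^ 2) (fun q => s.reg (8 + q)) c i (numConf (2 * k ^ 2)) =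
          classCount (s.nat 2) (s.reg 1) b c i) →
      k * ((attempt k (2 * k ^ 2)).run s).val 4 0 ≤ (k + 1) * B := by
  generalize hK : 2 * k ^ 2 = K at *
  have h1 := run_clear s
  have fr1 : Frame _ s (clear.run s) := frame_run _ _
  simp only [attempt, run]
  set s1 := clear.run s
  have r0 : s1.reg 0 = s.reg 0 := fr1.reg 0 (by simp [clear, writesReg])
  have r1 : s1.reg 1 = s.reg 1 := fr1.reg 1 (by simp [clear, writesReg])
  have r8 : (fun q => s1.reg (8 + q)) = fun q => s.reg (8 + q) :=
    funext fun q => fr1.reg _ (by simp [clear, writesReg]; omega)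
  have n0 : s1.nat 0 = s.nat 0 := fr1.nat 0 (by simp [clear, writesNat])
  have n2 : s1.nat 2 = s.nat 2 := fr1.nat 2 (by simp [clear, writesNat])
  have v1 : s1.val 1 = s.val 1 := fr1.val 1 (by simp [clear, writesVal])
  have v4 : s1.val 4 = s.val 4 := fr1.val 4 (by simp [clear, writesVal])
  have h2 := run_placeAll K (K + 1) s1
  have fr2 : Frame _ s1 ((placeAll K (K + 1)).run s1) := frame_run _ _
  set s2 := (placeAll K (K + 1)).run s1
  have r0' : s2.reg 0 = s1.reg 0 := fr2.reg 0 fun h => by have := writesReg_placeAll h; omega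
  have r1' : s2.reg 1 = s1.reg 1 := fr2.reg 1 fun h => by have := writesReg_placeAll h; omega
  have n0' : s2.nat 0 = s1.nat 0 := fr2.nat 0 fun h => by have := writesNat_placeAll h; omega
  have n2' : s2.nat 2 = s1.nat 2 := fr2.nat 2 fun h => by have := writesNat_placeAll h; omega
  have v1' : s2.val 1 = s1.val 1 := fr2.val 1 (writesVal_placeAll _ _ _)
  have v4' : s2.val 4 = s1.val 4 := fr2.val 4 (writesVal_placeAll _ _ _)
  rw [r0, r1, r8, n2] at h2
  rw [r0] at r0'
  rw [r1] at r1'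
  rw [n0] at n0'
  rw [n2] at n2'
  rw [v1] at v1'
  rw [v4] at v4'
  obtain ⟨hval, hcount⟩ := h2 hn fun e he => by rw [h1 e he]; exact hn
  have h3 := run_polish (r := k) (K := K) s2
  rw [r0', r1', n2', v1', v4'] at h3
  obtain ⟨hgood, hle, a, hinv, hM⟩ := h3 hn hd hval hcls
  refine ⟨fun hg => hgood (hg.congr r0' r1' n0' v1' v4'), hle, ?_⟩
  intro b B G hr hG hGB hb hB hguess
  have hk' : (0 : ℝ) < k := by exact_mod_cast hk
  have hab : ∀ c, k ≤ c → c ≤ 2 * k ^ 2 → ∀ i < s.reg 0,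
      classCount (s.nat 2) (s.reg 1) (s2.nat 1) c i = classCount (s.nat 2) (s.reg 1) b c i := by
    intro c hkc hcK i hi
    rw [hK] at hcK
    rw [hcount c (by omega) ?_ i hi, hguess c hkc hcK i hi]
    rw [Finset.sum_congr rfl fun i hi => hguess c hkc hcK i (Finset.mem_range.1 hi)]
    exact sum_classCount hb c
  rw [← hK] at hr
  rw [← le_div_iff₀' hk']
  refine hM _ fun i hi => ?_
  rw [le_div_iff₀' hk']
  exact load_le_of_classCount hn hk hd hr hG hGB hb hB hab hinv hi

/-- Run `p` for all values of the thresholds number `0, …, Q - 1` between `0` and the number of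
machines. -/
def nest (p : Prog) : ℕ → Prog
  | 0 => p
  | q + 1 => loop (8 + q) 0 1 (nest p q)

theorem lt_of_writesReg_nest {p : Prog} (hp8 : ∀ y, p.writesReg y → y < 8) {Q y : ℕ}
    (h : (nest p Q).writesReg y) : y < 8 + Q := by
  induction Q with
  | zero => exact hp8 y h
  | succ Q ih =>
    rcases h with rfl | h
    · omega
    · have := ih h
      omega

theorem writesNat_nest {p : Prog} {Q y : ℕ} (h : (nest p Q).writesNat y) : p.writesNat y := by
  induction Q with
  | zero => exact h
  | succ Q ih => exact ih h

theorem wf_nest {p : Prog} (hp : p.WF) (hp8 : ∀ y, p.writesReg y → y < 8) (Q : ℕ) :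
    (nest p Q).WF := by
  induction Q with
  | zero => exact hp
  | succ Q ih =>
    refine ⟨by omega, by omega, fun h => ?_, ih⟩
    have := lt_of_writesReg_nest hp8 h
    omega

theorem run_nest {p : Prog} (hp8 : ∀ y, p.writesReg y → y < 8) {I : State ℝ → Prop}
    (hI : ∀ s, I s → I (p.run s)) (hput : ∀ s q v, I s → I (s.putReg (8 + q) v)) (Q : ℕ)
    {s : State ℝ} (hs : I s) : I ((nest p Q).run s) := by
  induction Q generalizing s with
  | zero => exact hI s hs
  | succ Q ih =>
    refine run_loop (fun _ t => I t) (fun h => ?_) (hput _ _ _ hs)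
      fun i t _ _ _ ht => hput _ _ _ (ih ht)
    have := lt_of_writesReg_nest hp8 h
    omega

/-- If `p` achieves `J` when started with the thresholds `x`, and if `J` lasts, then the nested
loops achieve `J`. -/
theorem run_nest_hit {p : Prog} (hp8 : ∀ y, p.writesReg y → y < 8) {n Q : ℕ}
    {I J : State ℝ → Prop} {x : ℕ → ℕ} (hx : ∀ q, x q ≤ n) (hI0 : ∀ s, I s → s.reg 0 = n)
    (hI : ∀ s, I s → I (p.run s)) (hIput : ∀ s q v, I s → I (s.putReg (8 + q) v))
    (hJ : ∀ s, I s → J s → J (p.run s)) (hJput : ∀ s q v, J s → J (s.putReg (8 + q) v))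
    (hit : ∀ s, I s → (∀ q < Q, s.reg (8 + q) = x q) → J (p.run s))
    {s : State ℝ} (hs : I s) : J ((nest p Q).run s) := by
  have key : ∀ q ≤ Q, ∀ s, I s → (∀ q', q ≤ q' → q' < Q → s.reg (8 + q') = x q') →
      J ((nest p q).run s) := by
    intro q
    induction q with
    | zero => exact fun _ s hs hq => hit s hs fun q' hq' => hq q' (Nat.zero_le _) hq'
    | succ q ih =>
      intro hqQ s hs hq
      have hnw : ¬ (nest p q).writesReg (8 + q) := fun h => by
        have := lt_of_writesReg_nest hp8 h
        omega
      have h := run_loop (x := 8 + q) (r := 0) (k := 1) (p := nest p q) (s := s)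
        (fun i t => I t ∧ (x q < i → J t)) hnw
        ⟨hIput _ _ _ hs, fun h => absurd h (Nat.not_lt_zero _)⟩ ?_
      · exact h.2 (by rw [hI0 s hs]; exact Nat.lt_succ_of_le (hx q))
      · rintro i t hi hti hfr ⟨h1, h2⟩
        refine ⟨hIput _ _ _ (run_nest hp8 hI hIput q h1), fun hlt => hJput _ _ _ ?_⟩
        rcases Nat.lt_succ_iff_lt_or_eq.1 hlt with h | h
        · exact (run_nest (I := fun s => I s ∧ J s) hp8 (fun s h => ⟨hI s h.1, hJ s h.1 h.2⟩)
            (fun s q v h => ⟨hIput s q v h.1, hJput s q v h.2⟩) q ⟨h1, h2 h⟩).2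
        · refine ih (by omega) t h1 fun q' hq1 hq2 => ?_
          rcases eq_or_lt_of_le hq1 with rfl | hq3
          · rw [hti, h]
          · rw [← hq q' hq3 hq2]
            refine hfr.reg _ fun hw => ?_
            rcases hw with hw | hw
            · omega
            · have := lt_of_writesReg_nest hp8 hw
              omega
  exact key Q le_rfl s hs fun q' h1 h2 => absurd h2 (by omega)

end Prog

/-- The `k`-fold sum of an expression. -/
def VExp.rep (v : VExp) : ℕ → VExp
  | 0 => .zero
  | k + 1 => .add (v.rep k) v

theorem VExp.eval_rep (v : VExp) (k : ℕ) (s : State ℝ) : (v.rep k).eval s = k * v.eval s := by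
  induction k with
  | zero => simp [rep, eval]
  | succ k ih => rw [rep, eval, ih]; push_cast; ring

namespace Prog

/-- Compute the class, up to `J`, of item number `e` (in register `3`). -/
def classOf (K : ℕ) : ℕ → Prog
  | 0 => setNat 2 (.reg 3) (.lit 0)
  | j + 1 => seq (classOf K j) (branch
      (.neg (.vlt (VExp.rep (.get 1 (.reg 3)) K) (VExp.rep (.get 5 (.lit 0)) (j + 1))))
      (setNat 2 (.reg 3) (.lit (j + 1))) skip)

theorem run_classOf (K J : ℕ) (s : State ℝ) :
    ∃ c ≤ J, (classOf K J).run s = s.putNat 2 (s.reg 3) c ∧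
      (c = 0 ∨ c * s.val 5 0 ≤ K * s.val 1 (s.reg 3)) ∧
      (c < J → K * s.val 1 (s.reg 3) ≤ (c + 1) * s.val 5 0) := by
  induction J with
  | zero => exact ⟨0, le_rfl, rfl, Or.inl rfl, fun h => absurd h (Nat.not_lt_zero _)⟩
  | succ J ih =>
    obtain ⟨c, hc, heq, h1, h2⟩ := ih
    rw [classOf, run, heq, run]
    by_cases h : (K : ℝ) * s.val 1 (s.reg 3) < ((J + 1 : ℕ) : ℝ) * s.val 5 0
    · refine ⟨c, by omega, ?_, h1, fun _ => ?_⟩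
      · rw [if_neg (by simpa [BExp.eval, VExp.eval_rep, VExp.eval, NExp.eval] using h)]
        rfl
      · rcases Nat.lt_or_eq_of_le hc with hc | rfl
        · exact h2 hc
        · exact_mod_cast h.le
    · refine ⟨J + 1, le_rfl, ?_, Or.inr (not_lt.1 h), fun h => absurd h (lt_irrefl _)⟩
      rw [if_pos (by simpa [BExp.eval, VExp.eval_rep, VExp.eval, NExp.eval] using h)]
      ext x y
      · rfl
      · simp only [run, NExp.eval, putNat_nat, putNat_reg]
        split_ifs <;> simp
      · rfl

@[simp] theorem writesReg_classOf (K J y : ℕ) : ¬ (classOf K J).writesReg y := by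
  induction J <;> simp_all [classOf, writesReg]

@[simp] theorem writesNat_classOf (K J y : ℕ) : (classOf K J).writesNat y ↔ y = 2 := by
  induction J <;> simp_all [classOf, writesNat]

@[simp] theorem writesVal_classOf (K J y : ℕ) : ¬ (classOf K J).writesVal y := by
  induction J <;> simp_all [classOf, writesVal]

@[simp] theorem wf_classOf (K J : ℕ) : (classOf K J).WF := by
  induction J <;> simp_all [classOf, WF]

/-- Round the costs. -/
def classify (K : ℕ) : Prog := loop 3 1 0 (classOf K K)

theorem run_classify {K : ℕ} (s : State ℝ) (hd : ∀ e < s.reg 1, 0 ≤ s.val 1 e)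
    (hG : 0 ≤ s.val 5 0) (hdG : ∀ e < s.reg 1, s.val 1 e ≤ s.val 5 0) :
    Rounds (s.reg 1) (s.val 1) (s.val 5 0) K (((classify K).run s).nat 2) := by
  have h := run_loop (x := 3) (r := 1) (k := 0) (p := classOf K K) (s := s)
    (fun e t => ∀ e' < e, t.nat 2 e' ≤ K ∧ t.nat 2 e' * s.val 5 0 ≤ K * s.val 1 e' ∧
      K * s.val 1 e' ≤ (t.nat 2 e' + 1) * s.val 5 0) (by simp) (by simp) ?_
  · exact ⟨fun e he => (h e he).1, fun e he => (h e he).2.1, fun e he => (h e he).2.2⟩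
  · intro e t he hte hfr h e' he'
    have hv : t.val 1 = s.val 1 := hfr.val 1 (by simp [writesVal])
    have hv5 : t.val 5 = s.val 5 := hfr.val 5 (by simp [writesVal])
    obtain ⟨c, hc, heq, h1, h2⟩ := run_classOf K K t
    rw [hte, hv, hv5] at h1 h2
    rw [heq, hte]
    simp only [putReg_nat, putNat_nat, if_pos]
    rcases eq_or_ne e' e with rfl | hee
    · rw [Function.update_self]
      have hde := hd e' he
      refine ⟨hc, ?_, ?_⟩
      · rcases h1 with rfl | h1
        · simp only [Nat.cast_zero, zero_mul]; positivity
        · exact h1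
      · rcases Nat.lt_or_eq_of_le hc with hc | rfl
        · exact h2 hc
        · have := mul_le_mul_of_nonneg_left (hdG e' he) (Nat.cast_nonneg (α := ℝ) c)
          linarith
    · rw [Function.update_of_ne hee]
      exact h e' (by omega)

/-- Compute a first fair schedule, starting with all items on machine `0`. -/
def first : Prog :=
  seq (setReg 6 (.lit 1)) (seq loads (seq pass (seq makespan (seq copy
    (seq (setVal 4 (.lit 0) (.get 3 (.lit 0))) (setVal 5 (.lit 0) (.get 3 (.lit 0))))))))

theorem run_first (s : State ℝ) (hn : 0 < s.reg 0) (hd : ∀ e < s.reg 1, 0 ≤ s.val 1 e)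
    (hs1 : s.nat 1 = 0) (hs2 : s.nat 2 = 0) :
    Good (first.run s) ∧ (first.run s).val 4 0 = (first.run s).val 5 0 ∧
      0 ≤ (first.run s).val 5 0 ∧ (∀ e < s.reg 1, s.val 1 e ≤ (first.run s).val 5 0) ∧
      ∀ b B, Valid (s.reg 0) (s.reg 1) b →
        (∀ i < s.reg 0, load (s.val 1) (s.reg 1) b i ≤ B) → (first.run s).val 5 0 ≤ 2 * B := by
  simp only [first, run, NExp.eval, VExp.eval]
  have h1 := run_loads (s.putReg 6 1)
  have fr1 : Frame _ (s.putReg 6 1) (loads.run (s.putReg 6 1)) := frame_run _ _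
  set s1 := loads.run (s.putReg 6 1)
  have r0 := fr1.reg 0 (by simp [loads, writesReg])
  have r1 := fr1.reg 1 (by simp [loads, writesReg])
  have r6 := fr1.reg 6 (by simp [loads, writesReg])
  have n1 := fr1.nat 1 (by simp [loads, writesNat])
  have n2 := fr1.nat 2 (by simp [loads, writesNat])
  have v1 := fr1.val 1 (by simp [loads, writesVal])
  simp only [putReg_nat, putReg_val, putReg_reg, if_true, hs1, hs2,
    show (0 : ℕ) ≠ 6 by norm_num, show (1 : ℕ) ≠ 6 by norm_num, if_false]
    at h1 r0 r1 r6 n1 n2 v1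
  have h2 := run_pass s1
  have fr2 : Frame _ s1 (pass.run s1) := frame_run _ _
  set s2 := pass.run s1
  have r0' := fr2.reg 0 (by simp [pass, improve, argmin, writesReg])
  have r1' := fr2.reg 1 (by simp [pass, improve, argmin, writesReg])
  have v1' := fr2.val 1 (by simp [pass, improve, argmin, writesVal])
  rw [r0, r1, r6, n1, n2, v1] at h2
  rw [r0] at r0'
  rw [r1] at r1'
  rw [v1] at v1'
  obtain ⟨hinv, hL⟩ := h2 hn hd (fun _ _ => hn) h1
  have hfair := hinv.fair hd fun e _ => by simp
  have h3 := run_makespan s2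
  have fr3 : Frame _ s2 (makespan.run s2) := frame_run _ _
  set s3 := makespan.run s2
  have r0'' := fr3.reg 0 (by simp [makespan, writesReg])
  have r1'' := fr3.reg 1 (by simp [makespan, writesReg])
  have n1'' := fr3.nat 1 (by simp [makespan, writesNat])
  have v1'' := fr3.val 1 (by simp [makespan, writesVal])
  rw [r0'] at h3 r0''
  rw [r1'] at r1''
  rw [v1'] at v1''
  obtain ⟨⟨i₀, hi₀, hM⟩, hmax⟩ := h3 hn
  have h4 := run_copy s3
  have fr4 : Frame _ s3 (copy.run s3) := frame_run _ _
  set s4 := copy.run s3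
  have r0₄ := fr4.reg 0 (by simp [copy, writesReg])
  have r1₄ := fr4.reg 1 (by simp [copy, writesReg])
  have v1₄ := fr4.val 1 (by simp [copy, writesVal])
  have v3₄ := fr4.val 3 (by simp [copy, writesVal])
  rw [r1'', n1''] at h4
  rw [r0''] at r0₄
  rw [r1''] at r1₄
  rw [v1''] at v1₄
  have hle : ∀ i < s.reg 0, load (s.val 1) (s.reg 1) (s2.nat 1) i ≤ s3.val 3 0 := fun i hi => by
    rw [← hL i hi]; exact hmax i hi
  simp only [putVal_val, if_true, if_false, show (4 : ℕ) ≠ 5 by norm_num,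
    show (3 : ℕ) ≠ 4 by norm_num, v3₄, Function.update_self]
  refine ⟨⟨?_, ?_, ?_⟩, trivial, ?_, fun e he => ?_, fun b B hb hB => ?_⟩
  · simp only [putVal_reg, putVal_nat, r0₄, r1₄]
    exact hinv.valid.congr h4
  · simp only [putVal_reg, putVal_nat, putVal_val, r0₄, r1₄, if_false, show (1 : ℕ) ≠ 5 by norm_num,
      show (1 : ℕ) ≠ 4 by norm_num, v1₄]
    exact hfair.congr h4
  · simp only [putVal_reg, putVal_nat, putVal_val, r0₄, r1₄, if_false, if_true,
      show (1 : ℕ) ≠ 5 by norm_num, show (4 : ℕ) ≠ 5 by norm_num, show (1 : ℕ) ≠ 4 by norm_num,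
      v1₄, Function.update_self]
    intro i hi
    rw [load_congr (b := s2.nat 1) (d' := s.val 1) (fun e he => ⟨h4 e he, rfl⟩)]
    exact hle i hi
  · exact (load_nonneg hd (s2.nat 1) 0).trans (hle 0 hn)
  · exact (le_load hd (s2.nat 1) he).trans (hle _ (hinv.valid e he))
  · rw [hM, hL i₀ hi₀]
    exact hfair.load_le hn hd hinv.valid hb hB hi₀

end Prog

/-! ### The whole program -/

namespace Prog

/-- The approximation scheme for items of common cost. -/
def schedule (k : ℕ) : Prog :=
  seq first (seq (classify (2 * k ^ 2)) (nest (attempt k (2 * k ^ 2)) (numConf (2 * k ^ 2))))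

theorem run_schedule {k : ℕ} (s : State ℝ) (hk : 0 < k) (hn : 0 < s.reg 0)
    (hd : ∀ e < s.reg 1, 0 ≤ s.val 1 e) (hs1 : s.nat 1 = 0) (hs2 : s.nat 2 = 0) :
    Valid (s.reg 0) (s.reg 1) (((schedule k).run s).nat 0) ∧
    Fair (s.reg 0) (s.reg 1) (s.val 1) (((schedule k).run s).nat 0) ∧
    ∀ b B, Valid (s.reg 0) (s.reg 1) b → (∀ i < s.reg 0, load (s.val 1) (s.reg 1) b i ≤ B) →
      ∀ i < s.reg 0,
        k * load (s.val 1) (s.reg 1) (((schedule k).run s).nat 0) i ≤ (k + 1) * B := by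
  obtain ⟨hgood, hbest, hG, hdG, hG2⟩ := run_first s hn hd hs1 hs2
  have fr1 : Frame _ s (first.run s) := frame_run _ _
  simp only [schedule, run]
  set s1 := first.run s
  have r0 : s1.reg 0 = s.reg 0 :=
    fr1.reg 0 (by simp [first, loads, pass, improve, argmin, makespan, copy, writesReg])
  have r1 : s1.reg 1 = s.reg 1 :=
    fr1.reg 1 (by simp [first, loads, pass, improve, argmin, makespan, copy, writesReg])
  have v1 : s1.val 1 = s.val 1 :=
    fr1.val 1 (by simp [first, loads, pass, improve, argmin, makespan, copy, writesVal])
  generalize hK : 2 * k ^ 2 = K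
  have h2 := run_classify (K := K) s1
  have fr2 : Frame _ s1 ((classify K).run s1) := frame_run _ _
  set s2 := (classify K).run s1
  have r0' : s2.reg 0 = s1.reg 0 := fr2.reg 0 (by simp [classify, writesReg])
  have r1' : s2.reg 1 = s1.reg 1 := fr2.reg 1 (by simp [classify, writesReg])
  have n0' : s2.nat 0 = s1.nat 0 := fr2.nat 0 (by simp [classify, writesNat])
  have v1' : s2.val 1 = s1.val 1 := fr2.val 1 (by simp [classify, writesVal])
  have v4' : s2.val 4 = s1.val 4 := fr2.val 4 (by simp [classify, writesVal])
  rw [r1, v1] at h2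
  have hr := h2 hd hG hdG
  have hgood2 : Good s2 := hgood.congr r0' r1' n0' v1' v4'
  rw [r0] at r0'
  rw [r1] at r1'
  rw [v1] at v1'
  set G := s1.val 5 0
  set cls := s2.nat 2 with hcls
  let I : State ℝ → Prop := fun t => t.reg 0 = s.reg 0 ∧ t.reg 1 = s.reg 1 ∧ t.nat 2 = cls ∧
    t.val 1 = s.val 1 ∧ Good t ∧ t.val 4 0 ≤ G
  have hp8 : ∀ y, (attempt k K).writesReg y → y < 8 := fun y h => by
    have := writesReg_attempt h
    omega
  have hIput : ∀ t q v, I t → I (t.putReg (8 + q) v) := by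
    rintro t q v ⟨h1, h2, h3, h4, h5, h6⟩
    have e0 : (t.putReg (8 + q) v).reg 0 = t.reg 0 := by
      rw [putReg_reg, if_neg (by omega)]
    have e1 : (t.putReg (8 + q) v).reg 1 = t.reg 1 := by
      rw [putReg_reg, if_neg (by omega)]
    exact ⟨e0.trans h1, e1.trans h2, h3, h4, h5.congr e0 e1 rfl rfl rfl, h6⟩
  have hattempt : ∀ t, I t → _ := fun t ht => run_attempt (k := k) t hk
    (by rw [ht.1]; exact hn) (by rw [ht.2.1, ht.2.2.2.1]; exact hd)
    (by rw [ht.2.1, ht.2.2.1, hK]; exact hr.le)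
  rw [hK] at hattempt
  have hI : ∀ t, I t → I ((attempt k K).run t) := by
    intro t ht
    obtain ⟨a1, a2, -⟩ := hattempt t ht
    obtain ⟨h1, h2, h3, h4, h5, h6⟩ := ht
    have fr : Frame _ t ((attempt k K).run t) := frame_run _ _
    refine ⟨(fr.reg 0 fun h => ?_).trans h1, (fr.reg 1 fun h => ?_).trans h2,
      (fr.nat 2 fun h => ?_).trans h3, (fr.val 1 fun h => ?_).trans h4, a1 h5, a2.trans h6⟩
    · have := writesReg_attempt h; omega
    · have := writesReg_attempt h; omega
    · have := writesNat_attempt h; omega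
    · have := writesVal_attempt h; omega
  have hI2 : I s2 := ⟨r0', r1', rfl, v1', hgood2, by rw [v4', hbest]⟩
  obtain ⟨f0, f1, -, f4, fgood, fG⟩ := run_nest hp8 hI hIput (numConf K) hI2
  have hvalid := fgood.valid
  have hfair := fgood.fair
  have hload := fgood.load_le
  rw [f0, f1] at hvalid
  rw [f0, f1, f4] at hfair hload
  refine ⟨hvalid, hfair, fun b B hb hB i hi => ?_⟩
  have hB0 : 0 ≤ B := (load_nonneg hd b 0).trans (hB 0 hn)
  have hk' : (0 : ℝ) ≤ k := Nat.cast_nonneg k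
  rcases le_or_gt G B with hGB | hGB
  · have h3 := mul_le_mul_of_nonneg_left (((hload i hi).trans fG).trans hGB) hk'
    linarith
  · obtain ⟨b', x, hb', hB', hx, hguess⟩ := exists_guess (k := k) hb hB fun c hc i hi =>
      classCount_le hk hd hr hGB hB0 hB hc hi
    have hJ := run_nest_hit (n := s.reg 0) (Q := numConf K) (I := I)
      (J := fun t => k * t.val 4 0 ≤ (k + 1) * B) hp8 hx (fun t ht => ht.1) hI hIput
      (fun t ht h => (mul_le_mul_of_nonneg_left (hattempt t ht).2.1 hk').trans h)
      (fun t q v h => h) (fun t ht hq => ?_) hI2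
    · exact (mul_le_mul_of_nonneg_left (hload i hi) hk').trans hJ
    · have h6 := (hattempt t ht).2.2 b' B G
      obtain ⟨h1, h2, h3, h4, -, -⟩ := ht
      rw [h1, h2, h3, h4] at h6
      refine h6 hr hG (hG2 b B hb hB) hb' hB' fun c hkc hcK i hi => ?_
      rw [← hguess c hkc hcK i hi]
      exact guess_congr hq

/-- Note the agent in register `2` if item number `e` (in register `3`) costs that agent nothing. -/
def tagItem : Prog :=
  branch (.neg (.vlt .zero (.get 0 (.add (.reg 5) (.reg 3)))))
    (seq (setNat 4 (.reg 3) (.add (.reg 2) (.lit 1))) (setVal 1 (.reg 3) .zero)) skip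

/-- Find the items that cost somebody nothing, and the common costs of the other items. -/
def prep : Prog :=
  seq (setReg 5 (.lit 0)) (seq (loop 3 1 0 (setVal 1 (.reg 3) (.get 0 (.reg 3))))
    (loop 2 0 0 (seq (loop 3 1 0 tagItem) (setReg 5 (.add (.reg 5) (.reg 1))))))

end Prog

/-- What is known about item `e`, of cost `c i e` to agent `i`, once the agents below `n` have been
considered: it has the common cost `d`, and the tag `g` is the number plus one of an agent for whom
it costs nothing, or `0` if there is no such agent. -/
def TagSpec (c : ℕ → ℕ → ℝ) (n e g : ℕ) (d : ℝ) : Prop :=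
  (g = 0 ∧ (∀ i < n, 0 < c i e) ∧ d = c 0 e) ∨ ∃ i < n, g = i + 1 ∧ c i e ≤ 0 ∧ d = 0

namespace Prog

theorem run_tagItems {c : ℕ → ℕ → ℝ} {i : ℕ} (s : State ℝ) (hi : s.reg 2 = i)
    (hc : ∀ e < s.reg 1, s.val 0 (s.reg 5 + e) = c i e)
    (h : ∀ e < s.reg 1, TagSpec c i e (s.nat 4 e) (s.val 1 e)) :
    ∀ e < s.reg 1, TagSpec c (i + 1) e (((loop 3 1 0 tagItem).run s).nat 4 e)
      (((loop 3 1 0 tagItem).run s).val 1 e) := by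
  refine fun e he => ((run_loop (x := 3) (r := 1) (k := 0) (p := tagItem) (s := s)
    (fun j t => ∀ e < s.reg 1, (e < j → TagSpec c (i + 1) e (t.nat 4 e) (t.val 1 e)) ∧
      (j ≤ e → TagSpec c i e (t.nat 4 e) (t.val 1 e))) (by simp [tagItem, writesReg])
    (fun e he => ⟨fun h => absurd h (Nat.not_lt_zero _), fun _ => h e he⟩) ?_) e he).1 (by simpa)
  intro j t hj htj hfr hinv
  rw [add_zero] at hj
  have ht2 : t.reg 2 = i := (hfr.reg 2 (by simp [tagItem, writesReg])).trans hi
  have ht5 : t.reg 5 = s.reg 5 := hfr.reg 5 (by simp [tagItem, writesReg])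
  have hv : t.val 0 = s.val 0 := hfr.val 0 (by simp [tagItem, writesVal])
  rw [tagItem, run]
  by_cases hpos : 0 < c i j
  · rw [if_neg (by simpa [BExp.eval, VExp.eval, NExp.eval, hv, htj, ht5, hc j hj] using hpos)]
    simp only [run, putReg_nat, putReg_val]
    refine fun e he => ⟨fun hej => ?_, fun hje => (hinv e he).2 (by omega)⟩
    rcases Nat.lt_succ_iff_lt_or_eq.1 hej with hej | rfl
    · exact (hinv e he).1 hej
    · rcases (hinv e he).2 le_rfl with ⟨h1, h2, h3⟩ | ⟨i', hi', h'⟩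
      · refine Or.inl ⟨h1, fun i' hi' => ?_, h3⟩
        rcases Nat.lt_succ_iff_lt_or_eq.1 hi' with hi' | rfl
        exacts [h2 i' hi', hpos]
      · exact Or.inr ⟨i', by omega, h'⟩
  · rw [if_pos (by simpa [BExp.eval, VExp.eval, NExp.eval, hv, htj, ht5, hc j hj] using hpos)]
    simp only [run, NExp.eval, VExp.eval, putReg_nat, putReg_val, putVal_nat, putVal_val,
      putNat_nat, putNat_val, putNat_reg, if_true, htj, ht2]
    refine fun e he => ?_
    rcases eq_or_ne e j with rfl | hne
    · refine ⟨fun _ => Or.inr ⟨i, by omega, ?_, not_lt.1 hpos, ?_⟩, fun h => absurd h (by omega)⟩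
      · rw [Function.update_self]
      · rw [Function.update_self]
    · rw [Function.update_of_ne hne, Function.update_of_ne hne]
      exact ⟨fun hej => (hinv e he).1 (by omega), fun hje => (hinv e he).2 (by omega)⟩

theorem run_prep (s : State ℝ) (hs : s.nat 4 = 0) : ∀ e < s.reg 1,
    TagSpec (fun i e => s.val 0 (i * s.reg 1 + e)) (s.reg 0) e ((prep.run s).nat 4 e)
      ((prep.run s).val 1 e) := by
  have h1 := run_loop (x := 3) (r := 1) (k := 0) (p := setVal 1 (.reg 3) (.get 0 (.reg 3)))
    (s := s.putReg 5 0) (fun e t => ∀ e' < e, t.val 1 e' = s.val 0 e') (by simp [writesReg])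
    (by simp) ?_
  swap
  · intro e t he hte hfr h e' he'
    have hv : t.val 0 = s.val 0 := hfr.val 0 (by simp [writesVal])
    simp only [run, NExp.eval, VExp.eval, hte, hv, putReg_val, putVal_val, if_pos]
    rcases eq_or_ne e' e with rfl | hee
    · rw [Function.update_self]
    · rw [Function.update_of_ne hee]
      exact h e' (by omega)
  have fr1 : Frame _ (s.putReg 5 0)
    ((loop 3 1 0 (setVal 1 (.reg 3) (.get 0 (.reg 3)))).run (s.putReg 5 0)) := frame_run _ _
  simp only [prep, run_seq, run_setReg, NExp.eval]
  set u := (loop 3 1 0 (setVal 1 (.reg 3) (.get 0 (.reg 3)))).run (s.putReg 5 0)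
  have r0 := fr1.reg 0 (by simp [writesReg])
  have r1 := fr1.reg 1 (by simp [writesReg])
  have r5 := fr1.reg 5 (by simp [writesReg])
  have n4 := fr1.nat 4 (by simp [writesNat])
  have v0 := fr1.val 0 (by simp [writesVal])
  simp only [putReg_reg, putReg_nat, putReg_val, if_true, if_false, hs,
    show (0 : ℕ) ≠ 5 by norm_num, show (1 : ℕ) ≠ 5 by norm_num] at r0 r1 r5 n4 v0 h1
  have h2 := run_loop (x := 2) (r := 0) (k := 0)
    (p := seq (loop 3 1 0 tagItem) (setReg 5 (.add (.reg 5) (.reg 1)))) (s := u)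
    (fun i t => t.reg 5 = i * s.reg 1 ∧ ∀ e < s.reg 1,
      TagSpec (fun i e => s.val 0 (i * s.reg 1 + e)) i e (t.nat 4 e) (t.val 1 e))
    (by simp [tagItem, writesReg]) ?_ ?_
  · rw [r0, add_zero] at h2
    exact h2.2
  · refine ⟨by simp [r5], fun e he => Or.inl ⟨?_, by simp, ?_⟩⟩
    · rw [putReg_nat, n4]; rfl
    · simpa using h1 e he
  · rintro i t hi hti hfr ⟨h5, h⟩
    have ht1 : t.reg 1 = s.reg 1 := (hfr.reg 1 (by simp [tagItem, writesReg])).trans r1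
    have hv : t.val 0 = s.val 0 := (hfr.val 0 (by simp [tagItem, writesVal])).trans v0
    have fr : Frame _ t ((loop 3 1 0 tagItem).run t) := frame_run _ _
    have w5 : ((loop 3 1 0 tagItem).run t).reg 5 = t.reg 5 :=
      fr.reg 5 (by simp [tagItem, writesReg])
    have w1 : ((loop 3 1 0 tagItem).run t).reg 1 = t.reg 1 :=
      fr.reg 1 (by simp [tagItem, writesReg])
    have h3 := run_tagItems (c := fun i e => s.val 0 (i * s.reg 1 + e)) t hti
      (by rw [hv, h5]; exact fun _ _ => rfl) (by rw [ht1]; exact h)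
    rw [ht1] at h3
    rw [run]
    generalize (loop 3 1 0 tagItem).run t = v at *
    simp only [run, NExp.eval, putReg_nat, putReg_val]
    refine ⟨?_, h3⟩
    simp [w5, w1, h5, ht1, add_mul]

/-- Give the tagged items to the agents for whom they cost nothing. -/
def finish : Prog :=
  loop 3 1 0 (branch (.nlt (.lit 0) (.get 4 (.reg 3)))
    (setNat 0 (.reg 3) (.sub (.get 4 (.reg 3)) (.lit 1))) skip)

theorem run_finish (s : State ℝ) : ∀ e < s.reg 1, (finish.run s).nat 0 e =
    if 0 < s.nat 4 e then s.nat 4 e - 1 else s.nat 0 e := by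
  refine fun e he => ((run_loop (x := 3) (r := 1) (k := 0)
    (p := branch (.nlt (.lit 0) (.get 4 (.reg 3)))
      (setNat 0 (.reg 3) (.sub (.get 4 (.reg 3)) (.lit 1))) skip) (s := s)
    (fun j t => ∀ e, t.nat 0 e =
      if e < j ∧ 0 < s.nat 4 e then s.nat 4 e - 1 else s.nat 0 e)
    (by simp [writesReg]) (by simp) ?_) e).trans (by simp [he])
  intro j t hj htj hfr h e
  have hn : t.nat 4 = s.nat 4 := hfr.nat 4 (by simp [writesNat])
  rw [run]
  by_cases hpos : 0 < s.nat 4 j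
  · rw [if_pos (by simpa [BExp.eval, NExp.eval, htj, hn] using hpos)]
    simp only [run, NExp.eval, htj, hn, putReg_nat, putNat_nat, if_true]
    rcases eq_or_ne e j with rfl | hne
    · simp [hpos]
    · rw [Function.update_of_ne hne, h e]
      have : e < j + 1 ↔ e < j := by omega
      simp only [this]
  · rw [if_neg (by simpa [BExp.eval, NExp.eval, htj, hn] using hpos)]
    simp only [run, putReg_nat]
    rw [h e]
    rcases eq_or_ne e j with rfl | hne
    · simp [hpos]
    · have : e < j + 1 ↔ e < j := by omega
      simp only [this]

/-- The whole algorithm, with error parameter `1 / k`. -/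
def solve (k : ℕ) : Prog := seq prep (seq (schedule k) finish)

theorem wf_solve (k : ℕ) : (solve k).WF := by
  have h8 : ∀ y, (attempt k (2 * k ^ 2)).writesReg y → y < 8 := fun y h => by
    have := writesReg_attempt h
    omega
  have := wf_nest (wf_attempt k (2 * k ^ 2)) h8 (numConf (2 * k ^ 2))
  simp [solve, prep, schedule, first, classify, finish, tagItem, loads, pass, improve, argmin,
    makespan, copy, WF, writesReg, this]

theorem run_solve {k : ℕ} (s : State ℝ) (hk : 0 < k) (hn : 0 < s.reg 0) (hs : s.nat = 0)
    (hc : ∀ i < s.reg 0, ∀ e < s.reg 1, 0 ≤ s.val 0 (i * s.reg 1 + e)) :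
    ∃ (d : ℕ → ℝ) (g x : ℕ → ℕ),
      (∀ e < s.reg 1, TagSpec (fun i e => s.val 0 (i * s.reg 1 + e)) (s.reg 0) e (g e) (d e)) ∧
      Valid (s.reg 0) (s.reg 1) x ∧ Fair (s.reg 0) (s.reg 1) d x ∧
      (∀ b B, Valid (s.reg 0) (s.reg 1) b → (∀ i < s.reg 0, load d (s.reg 1) b i ≤ B) →
        ∀ i < s.reg 0, k * load d (s.reg 1) x i ≤ (k + 1) * B) ∧
      ∀ e < s.reg 1, ((solve k).run s).nat 0 e = if 0 < g e then g e - 1 else x e := by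
  have h1 := run_prep s (by rw [hs]; rfl)
  have fr1 : Frame _ s (prep.run s) := frame_run _ _
  simp only [solve, run]
  set s1 := prep.run s
  have r0 : s1.reg 0 = s.reg 0 := fr1.reg 0 (by simp [prep, tagItem, writesReg])
  have r1 : s1.reg 1 = s.reg 1 := fr1.reg 1 (by simp [prep, tagItem, writesReg])
  have n1 : s1.nat 1 = s.nat 1 := fr1.nat 1 (by simp [prep, tagItem, writesNat])
  have n2 : s1.nat 2 = s.nat 2 := fr1.nat 2 (by simp [prep, tagItem, writesNat])
  have hd : ∀ e < s.reg 1, 0 ≤ s1.val 1 e := fun e he => by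
    rcases h1 e he with ⟨-, -, h⟩ | ⟨i, -, -, -, h⟩
    · rw [h]; exact hc 0 hn e he
    · rw [h]
  have h2 := run_schedule (k := k) s1 hk
  have fr2 : Frame _ s1 ((schedule k).run s1) := frame_run _ _
  have hwf : (schedule k).WF := (wf_solve k).2.1
  have n4' : ((schedule k).run s1).nat 4 = s1.nat 4 := fr2.nat 4 fun h => by
    rcases h with h | h | h
    · simp [first, loads, pass, improve, argmin, makespan, copy, writesNat] at h
    · simp [classify, writesNat] at h
    · have := writesNat_attempt (writesNat_nest h)
      omega
  have r1' : ((schedule k).run s1).reg 1 = s1.reg 1 :=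
    fr2.reg 1 (hwf.not_writesReg (by norm_num))
  set s2 := (schedule k).run s1
  rw [r0, r1] at h2
  obtain ⟨h3, h4, h5⟩ := h2 hn hd (by rw [n1, hs]; rfl) (by rw [n2, hs]; rfl)
  refine ⟨s1.val 1, s1.nat 4, s2.nat 0, h1, h3, h4, h5, ?_⟩
  have h6 := run_finish s2
  rw [r1', r1, n4'] at h6
  exact h6

end Prog

/-! ### From common costs back to restricted costs -/

section
variable {n m : ℕ} {c : Fin n → Fin m → ℝ} {d : ℕ → ℝ} {g x : ℕ → ℕ} {a : Fin m → Fin n}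

/-- An allocation, as a schedule. -/
def extend (b : Fin m → Fin n) (e : ℕ) : ℕ := if h : e < m then b ⟨e, h⟩ else 0

theorem extend_coe (b : Fin m → Fin n) (e : Fin m) : extend b e = b e := by
  simp [extend]

theorem valid_extend (b : Fin m → Fin n) : Valid n m (extend b) := fun e he => by
  rw [extend, dif_pos he]; exact Fin.is_lt _

theorem load_eq_sum_fin (d : ℕ → ℝ) (y : ℕ → ℕ) (i : ℕ) :
    load d m y i = ∑ e : Fin m, if y e = i then d e else 0 := by
  rw [load, Finset.sum_range]

theorem cost_bundle (c : Fin n → Fin m → ℝ) (b : Fin m → Fin n) (i j : Fin n) :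
    cost c i (bundle b j) = ∑ e, if b e = j then c i e else 0 := by
  rw [cost, bundle, Finset.sum_filter]

/-- The guarantees for `x` carry over to the allocation `a` that makes an exception for tagged
items. If an agent gets an item that costs somebody nothing, it costs that agent nothing, and the
other items have the common costs `d`. Hence a bundle costs its owner what the schedule `x` costs
with respect to `d`, and no agent values any bundle at less than its cost with respect to `d`. -/
theorem guarantees_of_schedule (hn : 0 < n) (hr : IsRestricted c)
    (hg : ∀ e : Fin m, (g e = 0 ∧ (∀ i, 0 < c i e) ∧ d e = c ⟨0, hn⟩ e) ∨
      ∃ i : Fin n, g e = i + 1 ∧ c i e = 0 ∧ d e = 0)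
    (hx : Valid n m x) (hf : Fair n m d x) {α : ℝ}
    (hM : ∀ b B, Valid n m b → (∀ i < n, load d m b i ≤ B) → ∀ i < n, load d m x i ≤ α * B)
    (ha : ∀ e : Fin m, (a e : ℕ) = if 0 < g e then g e - 1 else x e) :
    IsEF1 c a ∧ IsApproxMMS α c a ∧ IsPO c a := by
  obtain ⟨hc, c₀, hc₀⟩ := hr
  have hle : ∀ (e : Fin m) i, d e ≤ c i e := by
    intro e i
    rcases hg e with ⟨-, h1, h2⟩ | ⟨_, -, -, h2⟩
    · rw [h2, (hc₀ _ e).resolve_left (h1 _).ne', (hc₀ i e).resolve_left (h1 i).ne']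
    · rw [h2]; exact hc i e
  have hown : ∀ e : Fin m, c (a e) e = d e := by
    intro e
    rcases hg e with ⟨-, h1, h2⟩ | ⟨i, h0, h1, h2⟩
    · rw [h2, (hc₀ _ e).resolve_left (h1 _).ne', (hc₀ _ e).resolve_left (h1 _).ne']
    · have : a e = i := Fin.ext (by rw [ha e, h0]; simp)
      rw [this, h1, h2]
  have hax : ∀ e : Fin m, d e ≠ 0 → (a e : ℕ) = x e := by
    intro e he
    rcases hg e with ⟨h0, -, -⟩ | ⟨_, -, -, h2⟩
    · rw [ha e, if_neg (by omega)]
    · exact absurd h2 he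
  have hcost : ∀ i : Fin n, cost c i (bundle a i) = load d m x i := by
    intro i
    rw [cost_bundle, load_eq_sum_fin]
    refine Finset.sum_congr rfl fun e _ => ?_
    by_cases he : d e = 0
    · by_cases hi : a e = i
      · rw [if_pos hi, ← hi, hown, he, ite_self]
      · rw [if_neg hi, he, ite_self]
    · rw [← hax e he]
      by_cases hi : a e = i
      · rw [if_pos hi, if_pos (by rw [hi]), ← hi, hown]
      · rw [if_neg hi, if_neg (by rwa [Fin.val_inj])]
  have hload_le : ∀ (b : Fin m → Fin n) (i j : Fin n),
      load d m (extend b) j ≤ cost c i (bundle b j) := by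
    intro b i j
    rw [cost_bundle, load_eq_sum_fin]
    refine Finset.sum_le_sum fun e _ => ?_
    simp only [extend_coe, Fin.val_inj]
    split_ifs
    exacts [hle e i, le_rfl]
  have hload_a : ∀ j : Fin n, load d m (extend a) j = load d m x j := by
    intro j
    rw [load_eq_sum_fin, load_eq_sum_fin]
    refine Finset.sum_congr rfl fun e _ => ?_
    by_cases he : d e = 0
    · rw [he, ite_self, ite_self]
    · rw [extend_coe, hax e he]
  refine ⟨fun i j => ?_, fun i => ?_, ?_⟩
  · rcases (bundle a i).eq_empty_or_nonempty with h0 | ⟨e₀, he₀⟩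
    · exact Or.inl h0
    right
    have hj : load d m x j ≤ cost c i (bundle a j) := (hload_a j) ▸ hload_le a i j
    have hmain : load d m x i ≤ load d m x j →
        ∃ e ∈ bundle a i, cost c i ((bundle a i).erase e) ≤ cost c i (bundle a j) := fun h =>
      ⟨e₀, he₀, (Finset.sum_le_sum_of_subset_of_nonneg (Finset.erase_subset _ _)
        fun e _ _ => hc i e).trans (((hcost i).trans_le h).trans hj)⟩
    rcases hf i i.2 j j.2 with h | ⟨w, hw, hxw, h⟩
    · exact hmain h
    · by_cases hdw : d w = 0
      · exact hmain (by linarith)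
      · have haw : a ⟨w, hw⟩ = i := Fin.ext ((hax ⟨w, hw⟩ hdw).trans hxw)
        have hmem : (⟨w, hw⟩ : Fin m) ∈ bundle a i := by simp [bundle, haw]
        refine ⟨⟨w, hw⟩, hmem, ?_⟩
        have h1 : cost c i ((bundle a i).erase ⟨w, hw⟩) + c i ⟨w, hw⟩ =
            cost c i (bundle a i) := Finset.sum_erase_add _ _ hmem
        have h2 := hown ⟨w, hw⟩
        rw [haw] at h2
        have h3 := hcost i
        simp only at h2
        linarith
  · have : Nonempty (Fin m → Fin n) := ⟨fun _ => ⟨0, hn⟩⟩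
    obtain ⟨b, hb⟩ := exists_eq_ciInf_of_finite
      (f := fun b : Fin m → Fin n => ⨆ j : Fin n, cost c i (bundle b j))
    rw [hcost, mms, ← hb]
    refine hM (extend b) _ (valid_extend b) (fun j hj => ?_) i i.2
    exact (hload_le b i ⟨j, hj⟩).trans
      (le_ciSup (f := fun j : Fin n => cost c i (bundle b j)) (Set.finite_range _).bddAbove ⟨j, hj⟩)
  · rintro ⟨b, h1, i, h2⟩
    have h3 : ∑ i, cost c i (bundle b i) < ∑ i, cost c i (bundle a i) :=
      Finset.sum_lt_sum (fun i _ => h1 i) ⟨i, Finset.mem_univ i, h2⟩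
    have h4 : ∑ i : Fin n, load d m (extend b) i ≤ ∑ i, cost c i (bundle b i) :=
      Finset.sum_le_sum fun i _ => hload_le b i i
    have h5 : ∑ i, cost c i (bundle a i) = ∑ i : Fin n, load d m x i :=
      Finset.sum_congr rfl fun i _ => hcost i
    have h6 : ∑ i : Fin n, load d m (extend b) i = ∑ i : Fin n, load d m x i := by
      rw [← Finset.sum_range fun i => load d m (extend b) i,
        ← Finset.sum_range fun i => load d m x i, sum_load (valid_extend b), sum_load hx]
    linarith

end

/-- The program computes a good allocation of a restricted instance with real costs. -/
theorem solve_spec {k : ℕ} (hk : 0 < k) {n m : ℕ} (hn : 0 < n) (c : Fin n → Fin m → ℝ)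
    (hr : IsRestricted c) : ∃ a : Fin m → Fin n,
      Outputs ((Prog.solve k).run (inputState c)) a ∧
      IsEF1 c a ∧ IsApproxMMS (1 + 1 / k) c a ∧ IsPO c a := by
  have hval : ∀ (i : Fin n) (e : Fin m), (inputState c).val 0 (i * m + e) = c i e := by
    intro i e
    have hlt : (i * m + e : ℕ) < n * m := by
      have h1 : (i + 1 : ℕ) * m ≤ n * m := Nat.mul_le_mul_right m i.2
      have h2 := e.2
      rw [add_mul, one_mul] at h1
      omega
    have hm : 0 < m := e.pos
    simp only [inputState]
    rw [dif_pos ⟨trivial, hlt⟩]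
    congr 1
    · congr 1
      rw [mul_comm, Nat.mul_add_div hm, Nat.div_eq_of_lt e.2, add_zero]
    · apply Fin.ext
      simp only
      rw [mul_comm, Nat.mul_add_mod, Nat.mod_eq_of_lt e.2]
  obtain ⟨d, g, x, hg, hx, hf, hM, hout⟩ := Prog.run_solve (inputState c) hk hn rfl
    fun i hi e he => (hval ⟨i, hi⟩ ⟨e, he⟩).symm ▸ hr.1 ⟨i, hi⟩ ⟨e, he⟩
  change ∀ e < m, TagSpec (fun i e => (inputState c).val 0 (i * m + e)) n e (g e) (d e) at hg
  change Valid n m x at hx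
  change Fair n m d x at hf
  change ∀ b B, Valid n m b → (∀ i < n, load d m b i ≤ B) →
    ∀ i < n, k * load d m x i ≤ (k + 1) * B at hM
  change ∀ e < m, _ at hout
  have hg' : ∀ e : Fin m, (g e = 0 ∧ (∀ i, 0 < c i e) ∧ d e = c ⟨0, hn⟩ e) ∨
      ∃ i : Fin n, g e = i + 1 ∧ c i e = 0 ∧ d e = 0 := by
    intro e
    rcases hg e e.2 with ⟨h1, h2, h3⟩ | ⟨i, hi, h1, h2, h3⟩
    · exact Or.inl ⟨h1, fun i => by rw [← hval]; exact h2 i i.2, by rw [h3, ← hval]⟩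
    · exact Or.inr ⟨⟨i, hi⟩, h1, le_antisymm (by rw [← hval]; exact h2) (hr.1 _ _), h3⟩
  have hlt : ∀ e : Fin m, (if 0 < g e then g e - 1 else x e) < n := by
    intro e
    rcases hg' e with ⟨h1, -, -⟩ | ⟨i, h1, -, -⟩
    · rw [if_neg (by omega)]; exact hx e e.2
    · rw [if_pos (by omega), h1]; exact i.2
  have hk' : (0 : ℝ) < k := by exact_mod_cast hk
  refine ⟨fun e => ⟨_, hlt e⟩, fun e => hout e e.2,
    guarantees_of_schedule hn hr hg' hx hf (fun b B hb hB i hi => ?_) fun e => rfl⟩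
  have h1 := hM b B hb hB i hi
  rw [← mul_le_mul_iff_of_pos_left hk']
  have : (k : ℝ) * ((1 + 1 / k) * B) = (k + 1) * B := by field_simp
  linarith

theorem IsApproxMMS.mono {n m : ℕ} {c : Fin n → Fin m → ℝ} {a : Fin m → Fin n} {α β : ℝ}
    (hc : ∀ i e, 0 ≤ c i e) (h : IsApproxMMS α c a) (hαβ : α ≤ β) : IsApproxMMS β c a :=
  fun i => (h i).trans (mul_le_mul_of_nonneg_right hαβ
    (Real.iInf_nonneg fun _ => Real.iSup_nonneg fun _ => Finset.sum_nonneg fun e _ => hc i e))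

end Chores

theorem mainTheorem5 (ε : ℝ) (hε : 0 < ε) :
    ∃ P : Chores.Cmd,
      (∃ p : Polynomial ℕ, ∀ (n m : ℕ), 0 < n → ∀ c : Fin n → Fin m → ℝ,
        Chores.IsRestricted c →
          ∃ (t : ℕ) (s : Chores.State ℝ) (a : Fin m → Fin n),
            Chores.Exec (Chores.unitCharge ℝ) P (Chores.inputState c) t s ∧
            t ≤ p.eval (n + m) ∧
            Chores.Outputs s a ∧
            Chores.IsEF1 c a ∧ Chores.IsApproxMMS (1 + ε) c a ∧ Chores.IsPO c a) ∧
      (∃ q : Polynomial ℕ, ∀ (n m : ℕ), 0 < n → ∀ c : Fin n → Fin m → ℚ,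
        Chores.IsRestricted (fun i e => (c i e : ℝ)) →
          ∃ (t : ℕ) (s : Chores.State ℚ) (a : Fin m → Fin n),
            Chores.Exec Chores.bitCharge P (Chores.inputState c) t s ∧
            t ≤ q.eval (Chores.inputBits c) ∧
            Chores.Outputs s a ∧
            Chores.IsEF1 (fun i e => (c i e : ℝ)) a ∧
            Chores.IsApproxMMS (1 + ε) (fun i e => (c i e : ℝ)) a ∧
            Chores.IsPO (fun i e => (c i e : ℝ)) a) := by
  obtain ⟨k, hk0, hk⟩ := Real.exists_nat_pos_inv_lt hε
  have hkε : (1 : ℝ) + 1 / k ≤ 1 + ε := by rw [one_div]; linarith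
  have hexec : ∀ (n m : ℕ) (c : Fin n → Fin m → ℝ), ∃ t,
      Chores.Exec (Chores.unitCharge ℝ) (Chores.Prog.solve k).compile (Chores.inputState c) t
        ((Chores.Prog.solve k).run (Chores.inputState c)) ∧
      t ≤ (Chores.Prog.solve k).timePoly.eval (n + m) := fun n m c =>
    Chores.Prog.exec_compile (Chores.Prog.wf_solve k) (Chores.inputState c)
  refine ⟨(Chores.Prog.solve k).compile, ⟨(Chores.Prog.solve k).timePoly,
    fun n m hn c hr => ?_⟩, ?_⟩
  · obtain ⟨t, hx, ht⟩ := hexec n m c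
    obtain ⟨a, ho, h1, h2, h3⟩ := Chores.solve_spec hk0 hn c hr
    exact ⟨t, _, a, hx, ht, ho, h1, h2.mono hr.1 hkε, h3⟩
  · obtain ⟨q, hq⟩ := Chores.exists_poly_bitCharge (Chores.Prog.solve k).compile
      (Chores.Prog.solve k).timePoly
    refine ⟨q, fun n m hn c hr => ?_⟩
    obtain ⟨t, hx, ht⟩ := hexec n m fun i e => (c i e : ℝ)
    obtain ⟨a, ho, h1, h2, h3⟩ := Chores.solve_spec hk0 hn _ hr
    obtain ⟨t', s, hx', ht', hs⟩ := hq n m c t _ hx ht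
    rw [hs] at ho
    exact ⟨t', s, a, hx', ht', ho, h1, h2.mono hr.1 hkε, h3⟩
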